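/- Let $H$ be a separable Hilbert space and let $A$ be an unbounded positive self-adjoint operator in $H$ that has a complete orthonormal system of eigenvectors $v_1,v_2,\dots$ with eigenvalues $0<\lambda_1\le\lambda_2\le\cdots\to+\infty$. For $\tau\in\mathbb R$ let $$D(A^\tau)=\Big\{g\in H:\ \sum_{k}\lambda_k^{2\tau}|(g,v_k)|^2<\infty\Big\},\qquad \|g\|_\tau^2=\sum_{k}\lambda_k^{2\tau}|(g,v_k)|^2 .$$ Let $0<\rho<1$, $T>0$, and put $$\partial_t^{\rho-1}h(t)=\frac1{\Gamma(1-\rho)}\int_0^t\frac{h(\xi)}{(t-\xi)^{\rho}}\,d\xi,\qquad \partial_t^\rho h(t)=\frac{d}{dt}\,\partial_t^{\rho-1}h(t)$$ (Bochner integral and derivative in the norm of $H$). For given $f:(0,T)\to H$ and $\Phi\in H$, a solution of the backward problem $$\partial_t^\rho u(t)+Au(t)=f(t)\quad(0<t<T),\qquad u(T)=\Phi, \tag{1}$$ is a function $u\in C((0,T];H)$ for which $\partial_t^\rho u$ and $Au$ exist and belong to $C((0,T);H)$ and which satisfies (1). Let $\varepsilon>0$. There is a constant $C>0$, independent of $f$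 and $\Phi$, such that the following holds. Suppose that $t^{1-\rho}f(t)\in C([0,T];D(A^{1+\varepsilon}))$ (that is, $t^{1-\rho}f(t)$, $0<t<T$, has an extension to $[0,T]$ that is continuous in the norm $\|\cdot\|_{1+\varepsilon}$). Then for every $\Phi\in D(A^2)$ problem (1) has a unique solution $u$; moreover, the limit below exists and $$\lim_{t\to0}\|\partial_t^{\rho-1}u(t)\|\le C\Big(\|\Phi\|_2+\max_{t\in[0,T]}\|t^{1-\rho}f(t)\|_{1+\varepsilon}\Big).$$ -/

import Mathlib

open Set Filter Topology MeasureTheory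

noncomputable section

/-- The integrand of the fractional integral of order `σ < 0` of `h` at time `t` is (Bochner)
integrable, so that the integral exists. -/
def FracIntegrable {H : Type*} [NormedAddCommGroup H] [NormedSpace ℝ H]
    (σ : ℝ) (h : ℝ → H) (t : ℝ) : Prop :=
  IntervalIntegrable (fun ξ : ℝ => ((t - ξ) ^ (σ + 1))⁻¹ • h ξ) volume 0 t

/-- The fractional integral of order `σ < 0`,
`∂_t^σ h(t) = Γ(-σ)⁻¹ ∫₀ᵗ h(ξ) / (t - ξ)^(σ + 1) dξ`, as a Bochner integral in `H`. -/
def fracInt {H : Type*} [NormedAddCommGroup H] [NormedSpace ℝ H]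
    (σ : ℝ) (h : ℝ → H) (t : ℝ) : H :=
  (Real.Gamma (-σ))⁻¹ • ∫ ξ in (0 : ℝ)..t, ((t - ξ) ^ (σ + 1))⁻¹ • h ξ

/-- On the interval `(0, T)` the function `h` has the Riemann-Liouville derivative `d` of order
`ρ ∈ (0, 1)`: the fractional integral `∂_t^(ρ-1) h` exists there, and is differentiable in the
norm of `H` with derivative `d`. -/
def HasRLDerivOn {H : Type*} [NormedAddCommGroup H] [NormedSpace ℝ H]
    (ρ : ℝ) (h d : ℝ → H) (T : ℝ) : Prop :=
  ∀ t ∈ Ioo 0 T, FracIntegrable (ρ - 1) h t ∧ HasDerivAt (fracInt (ρ - 1) h) (d t) t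

/-- `g` lies in the domain of the power `A^τ` of the operator with the orthonormal eigenbasis `v`
and the eigenvalues `lam`. -/
def MemPowDomain {𝕜 H : Type*} [RCLike 𝕜] [NormedAddCommGroup H] [InnerProductSpace 𝕜 H]
    (v : HilbertBasis ℕ 𝕜 H) (lam : ℕ → ℝ) (τ : ℝ) (g : H) : Prop :=
  Summable fun k : ℕ => lam k ^ (2 * τ) * ‖inner 𝕜 (v k) g‖ ^ 2

/-- The norm `‖g‖_τ = ‖A^τ g‖ = (∑ₖ λₖ^(2τ) |gₖ|²)^(1/2)` on the domain of `A^τ`. -/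
def powNorm {𝕜 H : Type*} [RCLike 𝕜] [NormedAddCommGroup H] [InnerProductSpace 𝕜 H]
    (v : HilbertBasis ℕ 𝕜 H) (lam : ℕ → ℝ) (τ : ℝ) (g : H) : ℝ :=
  Real.sqrt (∑' k : ℕ, lam k ^ (2 * τ) * ‖inner 𝕜 (v k) g‖ ^ 2)

/-- `F ∈ C([0, T]; D(A^τ))`, where `D(A^τ)` carries the norm `‖·‖_τ`. -/
def ContInPowDomain {𝕜 H : Type*} [RCLike 𝕜] [NormedAddCommGroup H] [InnerProductSpace 𝕜 H]
    (v : HilbertBasis ℕ 𝕜 H) (lam : ℕ → ℝ) (τ T : ℝ) (F : ℝ → H) : Prop :=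
  (∀ t ∈ Icc 0 T, MemPowDomain v lam τ (F t)) ∧
  ∀ s ∈ Icc 0 T, Tendsto (fun t => powNorm v lam τ (F t - F s)) (𝓝[Icc 0 T] s) (𝓝 0)

/-- `max_{t ∈ [0, T]} ‖F(t)‖_τ` (for `F ∈ C([0, T]; D(A^τ))` the supremum is attained). -/
def maxPowNorm {𝕜 H : Type*} [RCLike 𝕜] [NormedAddCommGroup H] [InnerProductSpace 𝕜 H]
    (v : HilbertBasis ℕ 𝕜 H) (lam : ℕ → ℝ) (τ T : ℝ) (F : ℝ → H) : ℝ :=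
  sSup ((fun t => powNorm v lam τ (F t)) '' Icc 0 T)

/-- `u` solves the backward problem `∂_t^ρ u(t) + A u(t) = f(t)` for `0 < t < T`, `u(T) = Φ`:
`u ∈ C((0, T]; H)`, the functions `∂_t^ρ u` (called `d` below) and `A u` (called `w` below) exist
and are continuous on `(0, T)`, and the equation and the final condition hold. -/
structure IsBackwardSolution {𝕜 H : Type*} [RCLike 𝕜] [NormedAddCommGroup H]
    [InnerProductSpace 𝕜 H] [NormedSpace ℝ H]
    (A : H →ₗ.[𝕜] H) (ρ T : ℝ) (f : ℝ → H) (Φ : H) (u : ℝ → H) : Prop where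
  continuousOn : ContinuousOn u (Ioc 0 T)
  equation : ∃ d w : ℝ → H,
    HasRLDerivOn ρ u d T ∧ ContinuousOn d (Ioo 0 T) ∧
    (∀ t ∈ Ioo 0 T, (u t, w t) ∈ A.graph) ∧ ContinuousOn w (Ioo 0 T) ∧
    ∀ t ∈ Ioo 0 T, d t + w t = f t
  final : u T = Φ

end

/-!
In the coordinate of the eigenvector `v k` the equation is the scalar fractional equation with
`λ = lam k`. Its fundamental solution is `e_λ(t) = t ^ (ρ - 1) E_{ρ,ρ}(-λ t ^ ρ)` (`mlKernel`), which
satisfies `∂_t^(ρ-1) e_λ = 1 - λ ∫ e_λ` (`volterra_rpow_neg_mlKernel`), and by variation of constants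
`u = e_λ c + e_λ * f`, where `c` is the value of `∂_t^(ρ-1) u` at `0` (`volterra_mild`). Hence the final
condition determines `c = (Φ - (e_λ * f)(T)) / e_λ(T)`, the limit in question is `‖c‖`, and everything
rests on the size of `E_{ρ,ρ}(-x)` for `x ≥ 0`:

* it is positive and decreasing (`mittagLeffler_neg_pos`, `mittagLeffler_neg_le`);
* `x E_{ρ,ρ}(-x)` is bounded (`mul_mittagLeffler_neg_le`);
* `(1 + x) ^ 2 E_{ρ,ρ}(-x)` is bounded below by a positive constant
  (`exists_le_sq_mul_mittagLeffler_neg`).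

All three come from one extremum principle (`deriv_volterra_rpow_neg_le`): if a function is
nonnegative on `(0, a)` and attains its minimum over `[a, t₀]` at `t₀`, its Riemann–Liouville
derivative at `t₀` is small, the more so the larger the integral of the function over `[0, a]`. It
yields a comparison principle (`pos_of_deriv_volterra_ge`), which is applied to `e_λ` and to
`e_λ - e_μ` for `λ < μ`. The upper bound is then `λ ∫₀¹ e_λ ≤ 1` combined with monotonicity, and the lower bound is the extremum principle for
`e_λ` at the point `1`. No integral representation of the Mittag-Leffler function is used.

The lower bound shows that dividing by `e_λ(T)` costs at most `λ ^ 2`, which is where `Φ ∈ D(A ^ 2)`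
enters. In the Duhamel term the factor `λ ^ (1 - ε)` (for `ε ≤ 1`) is absorbed by the decay of the kernel, at the
price of a singularity `(T - s) ^ (ρ ε - 1)`, which is still integrable; this leaves `A ^ (1 + ε) F`
(`exists_initial_value`). Conversely, for every `c` the mild solution is continuous with values in
`D(A)` for `t > 0` and solves the equation in the norm of `H` (`isBackwardSolution_mildSol`).

Uniqueness (`IsBackwardSolution.eqOn`) is proved coordinatewise. A solution of the homogeneous scalar
equation is a multiple of `e_λ`: after subtracting that multiple, its primitive is continuous, vanishes
at `0` and solves the same equation, so that it is zero by the extremum principle. Since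
`e_λ(T) > 0`, the final value `0` forces the multiple to vanish.
-/

/-! ### Beta integrals and Volterra convolution -/

lemma intervalIntegrable_rpow_mul_rpow {a b t : ℝ} (ha : 0 < a) (hb : 0 < b) (ht : 0 < t) :
    IntervalIntegrable (fun s : ℝ => (t - s) ^ (a - 1) * s ^ (b - 1)) volume 0 t := by
  have h1 : IntervalIntegrable (fun s : ℝ => (t - s) ^ (a - 1) * s ^ (b - 1)) volume 0 (t / 2) := by
    refine (intervalIntegral.intervalIntegrable_rpow' (by linarith)).continuousOn_mul ?_
    refine ContinuousOn.rpow_const (by fun_prop) fun s hs => Or.inl ?_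
    rw [uIcc_of_le (by positivity)] at hs
    linarith [hs.2]
  have h2 : IntervalIntegrable (fun s : ℝ => (t - s) ^ (a - 1) * s ^ (b - 1)) volume (t / 2) t := by
    refine IntervalIntegrable.mul_continuousOn ?_ ?_
    · have := (intervalIntegral.intervalIntegrable_rpow' (a := 0) (b := t / 2)
        (r := a - 1) (by linarith)).comp_sub_left t
      simp only [sub_zero] at this
      rw [show t - t / 2 = t / 2 by ring] at this
      exact this.symm
    · refine ContinuousOn.rpow_const (by fun_prop) fun s hs => Or.inl ?_
      rw [uIcc_of_le (by linarith)] at hs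
      linarith [hs.1]
  exact h1.trans h2

lemma integral_rpow_mul_rpow {a b t : ℝ} (ha : 0 < a) (hb : 0 < b) (ht : 0 < t) :
    ∫ s in (0 : ℝ)..t, (t - s) ^ (a - 1) * s ^ (b - 1) =
      t ^ (a + b - 1) * (Real.Gamma a * Real.Gamma b / Real.Gamma (a + b)) := by
  have h := Complex.betaIntegral_scaled (b : ℂ) (a : ℂ) ht
  rw [Complex.betaIntegral_eq_Gamma_mul_div _ _ (by simpa) (by simpa)] at h
  have h2 : ∫ x in (0 : ℝ)..t, (x : ℂ) ^ ((b : ℂ) - 1) * ((t : ℂ) - x) ^ ((a : ℂ) - 1) =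
      ∫ x in (0 : ℝ)..t, (((t - x) ^ (a - 1) * x ^ (b - 1) : ℝ) : ℂ) := by
    refine intervalIntegral.integral_congr fun x hx => ?_
    rw [uIcc_of_le ht.le] at hx
    rw [Complex.ofReal_mul, Complex.ofReal_cpow hx.1, Complex.ofReal_cpow (by linarith [hx.2])]
    push_cast
    ring
  rw [h2, intervalIntegral.integral_ofReal] at h
  apply Complex.ofReal_injective
  rw [h]
  push_cast
  rw [Complex.ofReal_cpow ht.le, ← Complex.Gamma_ofReal, ← Complex.Gamma_ofReal,
    ← Complex.Gamma_ofReal]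
  push_cast
  rw [add_comm (b : ℂ) a]
  ring

/-- The Volterra convolution `(a * f)(t) = ∫₀ᵗ a(t - s) f(s) ds` of a scalar kernel with a
vector-valued function. -/
noncomputable def volterra {E : Type*} [NormedAddCommGroup E] [NormedSpace ℝ E]
    (a : ℝ → ℝ) (f : ℝ → E) (t : ℝ) : E :=
  ∫ s in (0 : ℝ)..t, a (t - s) • f s

/-- Associativity of the Volterra convolution, together with the integrability that it needs.
The kernels are nonnegative and `a * b` is bounded, so that Fubini's theorem applies on the triangle
`0 < r < s < t` for every integrable `f`. -/
lemma volterra_assoc {E : Type*} [NormedAddCommGroup E] [NormedSpace ℝ E] [CompleteSpace E]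
    {a b : ℝ → ℝ} {f : ℝ → E} {t M : ℝ} (ht : 0 ≤ t) (ham : Measurable a) (hbm : Measurable b)
    (ha : ∀ x, 0 ≤ x → 0 ≤ a x) (hb : ∀ x, 0 ≤ x → 0 ≤ b x)
    (hab : ∀ τ ∈ Ioc 0 t, IntervalIntegrable (fun s => a (τ - s) * b s) volume 0 τ)
    (hM : ∀ τ ∈ Ioc 0 t, volterra a b τ ≤ M) (hf : IntervalIntegrable f volume 0 t) :
    IntervalIntegrable (fun s => a (t - s) • volterra b f s) volume 0 t ∧
    volterra a (volterra b f) t = volterra (volterra a b) f t := by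
  set μ := (volume : Measure ℝ).restrict (Ioc 0 t) with hμ
  set G : ℝ × ℝ → E := {p : ℝ × ℝ | p.2 < p.1}.indicator
    (fun p => (a (t - p.1) * b (p.1 - p.2)) • f p.2) with hG
  have hfμ : Integrable f μ := (intervalIntegrable_iff_integrableOn_Ioc_of_le ht).1 hf
  have hset : MeasurableSet {p : ℝ × ℝ | p.2 < p.1} := measurableSet_lt measurable_snd measurable_fst
  have hGm : AEStronglyMeasurable G (μ.prod μ) := by
    refine AEStronglyMeasurable.indicator ?_ hset
    refine AEStronglyMeasurable.smul ?_ hfμ.1.comp_snd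
    exact (((ham.comp (measurable_const.sub measurable_fst))).mul
      (hbm.comp (measurable_fst.sub measurable_snd))).aestronglyMeasurable
  -- the sections of `G` in the inner variable `r` and in the outer variable `s`
  have hsec (r : ℝ) : (fun s => G (s, r)) = (Ioi r).indicator
      (fun s => (a (t - s) * b (s - r)) • f r) := by
    ext s
    simp [hG, indicator_apply]
  have hsec' (s : ℝ) : (fun r => G (s, r)) = (Iio s).indicator
      (fun r => (a (t - s) * b (s - r)) • f r) := by
    ext r
    simp [hG, indicator_apply]
  have hset1 {r : ℝ} (hr : r ∈ Ioc 0 t) : Ioc 0 t ∩ Ioi r = Ioc r t := by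
    ext x; simp only [mem_inter_iff, mem_Ioc, mem_Ioi]
    exact ⟨fun h => ⟨h.2, h.1.2⟩, fun h => ⟨⟨hr.1.trans h.1, h.2⟩, h.1⟩⟩
  -- translation to the interval `[0, t - r]`
  have hshift {r : ℝ} (hr : r ∈ Ioc 0 t) :
      IntegrableOn (fun s => a (t - s) * b (s - r)) (Ioc r t) ∧
      ∫ s in Ioc r t, a (t - s) * b (s - r) = volterra a b (t - r) := by
    rcases eq_or_lt_of_le hr.2 with h | h
    · subst h; simp [volterra]
    have hh := hab (t - r) ⟨by linarith, by linarith [hr.1]⟩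
    have h1 := hh.comp_sub_right r
    have hfun : (fun s => a (t - r - (s - r)) * b (s - r)) = fun s => a (t - s) * b (s - r) := by
      ext s; rw [show t - r - (s - r) = t - s by ring]
    rw [hfun] at h1
    simp only [zero_add, sub_add_cancel] at h1
    refine ⟨(intervalIntegrable_iff_integrableOn_Ioc_of_le hr.2).1 h1, ?_⟩
    rw [← intervalIntegral.integral_of_le hr.2, volterra]
    have := intervalIntegral.integral_comp_sub_right (a := r) (b := t)
      (fun s => a (t - r - s) * b s) r
    simp only [sub_self] at this
    simp only [smul_eq_mul]
    rw [← this]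
    refine intervalIntegral.integral_congr fun s _ => ?_
    rw [show t - r - (s - r) = t - s by ring]
  have hnorm {r : ℝ} (hr : r ∈ Ioc 0 t) : ∫ s, ‖G (s, r)‖ ∂μ = volterra a b (t - r) * ‖f r‖ := by
    have : (fun s => ‖G (s, r)‖) = (Ioi r).indicator
        (fun s => ‖(a (t - s) * b (s - r)) • f r‖) := by
      ext s; rw [congrFun (hsec r) s, norm_indicator_eq_indicator_norm]
    rw [this, integral_indicator measurableSet_Ioi, hμ, Measure.restrict_restrict measurableSet_Ioi,
      inter_comm, hset1 hr, ← (hshift hr).2, ← integral_mul_const]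
    refine setIntegral_congr_fun measurableSet_Ioc fun s hs => ?_
    rw [norm_smul, Real.norm_of_nonneg (mul_nonneg (ha _ (by linarith [hs.2])) (hb _ (by linarith [hs.1])))]
  have hGi : Integrable G (μ.prod μ) := by
    rw [integrable_prod_iff' hGm]
    constructor
    · rw [hμ]
      filter_upwards [ae_restrict_mem measurableSet_Ioc] with r hr
      rw [hsec r, integrable_indicator_iff measurableSet_Ioi, IntegrableOn,
        Measure.restrict_restrict measurableSet_Ioi, inter_comm, hset1 hr]
      exact (hshift hr).1.smul_const _
    · refine Integrable.mono' (hfμ.norm.const_mul (max M 0)) ?_ ?_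
      · exact hGm.norm.prod_swap.integral_prod_right'
      · rw [hμ]
        filter_upwards [ae_restrict_mem measurableSet_Ioc] with r hr
        rw [Real.norm_of_nonneg (integral_nonneg fun _ => norm_nonneg _), ← hμ, hnorm hr]
        refine mul_le_mul_of_nonneg_right ?_ (norm_nonneg _)
        rcases eq_or_lt_of_le hr.2 with h | h
        · subst h; simp [volterra]
        · exact (hM _ ⟨by linarith, by linarith [hr.1]⟩).trans (le_max_left _ _)
  have hin {s : ℝ} (hs : s ∈ Ioc 0 t) : ∫ r, G (s, r) ∂μ = a (t - s) • volterra b f s := by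
    have hseq : Ioc 0 t ∩ Iio s = Ioo 0 s := by
      ext x; simp only [mem_inter_iff, mem_Ioc, mem_Iio, mem_Ioo]
      exact ⟨fun h => ⟨h.1.1, h.2⟩, fun h => ⟨⟨h.1, h.2.le.trans hs.2⟩, h.2⟩⟩
    rw [hsec' s, integral_indicator measurableSet_Iio, hμ, Measure.restrict_restrict measurableSet_Iio,
      inter_comm, hseq, volterra, intervalIntegral.integral_of_le hs.1.le, ← integral_smul,
      integral_Ioc_eq_integral_Ioo]
    simp only [smul_smul]
  have hout {r : ℝ} (hr : r ∈ Ioc 0 t) : ∫ s, G (s, r) ∂μ = volterra a b (t - r) • f r := by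
    rw [hsec r, integral_indicator measurableSet_Ioi, hμ, Measure.restrict_restrict measurableSet_Ioi,
      inter_comm, hset1 hr, ← (hshift hr).2, integral_smul_const]
  constructor
  · rw [intervalIntegrable_iff_integrableOn_Ioc_of_le ht]
    refine hGi.integral_prod_left.congr ?_
    rw [hμ]
    filter_upwards [ae_restrict_mem measurableSet_Ioc] with s hs
    exact hin hs
  · have hswap := integral_integral_swap (f := fun s r => G (s, r)) hGi
    rw [volterra, volterra, intervalIntegral.integral_of_le ht, intervalIntegral.integral_of_le ht,
      ← setIntegral_congr_fun measurableSet_Ioc fun s hs => hin hs,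
      ← setIntegral_congr_fun measurableSet_Ioc fun s hs => hout hs]
    exact hswap

/-! ### The extremum principle for the Riemann–Liouville derivative -/

lemma nonpos_of_hasDerivAt_of_le_left {P : ℝ → ℝ} {p t₀ : ℝ} (h : HasDerivAt P p t₀)
    (hP : ∀ᶠ t in 𝓝[<] t₀, P t₀ ≤ P t) : p ≤ 0 := by
  have h1 : Tendsto (slope P t₀) (𝓝[<] t₀) (𝓝 p) :=
    (hasDerivAt_iff_tendsto_slope.1 h).mono_left (nhdsWithin_mono _ fun x hx => ne_of_lt hx)
  refine le_of_tendsto h1 ?_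
  filter_upwards [hP, self_mem_nhdsWithin] with t ht ht'
  rw [slope_def_field]
  exact div_nonpos_of_nonneg_of_nonpos (by linarith) (by linarith [mem_Iio.1 ht'])

lemma rpow_neg_sub_rpow_neg_le {ρ x y t₀ : ℝ} (hρ : 0 < ρ) (hy : 0 < y) (hyx : y < x)
    (hx : x ≤ t₀) : x ^ (-ρ) - y ^ (-ρ) ≤ -(ρ * t₀ ^ (-ρ - 1)) * (x - y) := by
  obtain ⟨c, hc, h⟩ := exists_hasDerivAt_eq_slope (fun z : ℝ => z ^ (-ρ))
    (fun z => -ρ * z ^ (-ρ - 1)) hyx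
    (continuousOn_id.rpow_const fun z hz => Or.inl (hy.trans_le hz.1).ne')
    (fun z hz => Real.hasDerivAt_rpow_const (Or.inl (hy.trans hz.1).ne'))
  rw [eq_div_iff (by linarith)] at h
  rw [← h]
  have : t₀ ^ (-ρ - 1) ≤ c ^ (-ρ - 1) :=
    Real.rpow_le_rpow_of_nonpos (hy.trans hc.1) (hc.2.le.trans hx) (by linarith)
  have h2 := mul_le_mul_of_nonneg_left this hρ.le
  nlinarith

lemma integral_sub_rpow {r a t : ℝ} (hr : -1 < r) :
    ∫ s in a..t, (t - s) ^ r = (t - a) ^ (r + 1) / (r + 1) := by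
  have := intervalIntegral.integral_comp_sub_left (a := a) (b := t) (fun s => s ^ r) t
  rw [this, sub_self, integral_rpow (Or.inl hr), Real.zero_rpow (by linarith), sub_zero]

lemma intervalIntegrable_sub_rpow {r a b t : ℝ} (hr : -1 < r) :
    IntervalIntegrable (fun s => (t - s) ^ r) volume a b := by
  have := (intervalIntegral.intervalIntegrable_rpow' (a := t - a) (b := t - b) hr).comp_sub_left t
  simpa using this

/-- The extremum principle for the Riemann–Liouville derivative: if `d` is nonnegative on `(0, a)`
and on `(a, t₀)` it is at least `d t₀`, then the derivative at `t₀` of the convolution of `t ^ (-ρ)`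
with `d` is at most `(t₀ - a) ^ (-ρ) d(t₀) - ρ t₀ ^ (-ρ - 1) ∫₀ᵃ d`. -/
lemma deriv_volterra_rpow_neg_le {ρ : ℝ} (hρ0 : 0 < ρ) (hρ1 : ρ < 1) {d : ℝ → ℝ} {a t₀ D : ℝ}
    (ha : 0 ≤ a) (hat : a < t₀)
    (hint : ∀ t ∈ Ioc 0 t₀, IntervalIntegrable (fun s => (t - s) ^ (-ρ) * d s) volume 0 t)
    (hd : IntervalIntegrable d volume 0 t₀) (hd0 : ∀ s ∈ Ioo 0 a, 0 ≤ d s)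
    (hmin : ∀ s ∈ Ioo a t₀, d t₀ ≤ d s) (hdiff : DifferentiableAt ℝ d t₀)
    (hD : HasDerivAt (volterra (fun x => x ^ (-ρ)) d) D t₀) :
    D ≤ (t₀ - a) ^ (-ρ) * d t₀ - ρ * t₀ ^ (-ρ - 1) * ∫ s in (0 : ℝ)..a, d s := by
  set c := ρ * t₀ ^ (-ρ - 1) * ∫ s in (0 : ℝ)..a, d s with hc
  set N := volterra (fun x => x ^ (-ρ)) d with hN
  obtain ⟨K, hK⟩ := hdiff.hasDerivAt.isBigO_sub.bound
  have ht0 : 0 < t₀ := ha.trans_lt hat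
  obtain ⟨η, hη, hηK⟩ := (mem_nhdsLT_iff_exists_Ioo_subset' hat).1
    (nhdsWithin_le_nhds hK : _ ∈ 𝓝[<] t₀)
  -- the comparison function, equal to `N` at `t₀` and at least `N t₀` to the left of it
  set P : ℝ → ℝ := fun t => N t + d t₀ * (((t₀ - a) ^ (1 - ρ) - (t - a) ^ (1 - ρ)) / (1 - ρ))
    - c * (t₀ - t) + K * ((t₀ - t) ^ (2 - ρ) / (2 - ρ)) with hP
  have hP' : HasDerivAt P (D - d t₀ * (t₀ - a) ^ (-ρ) + c) t₀ := by
    have h1 : HasDerivAt (fun t : ℝ => (t - a) ^ (1 - ρ)) ((1 - ρ) * (t₀ - a) ^ (-ρ)) t₀ := by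
      have := ((hasDerivAt_id t₀).sub_const a).rpow_const (p := 1 - ρ)
        (Or.inl (sub_pos.2 hat).ne')
      refine this.congr_deriv ?_
      rw [id, one_mul, show 1 - ρ - 1 = -ρ by ring]
    have h2 : HasDerivAt (fun t : ℝ => (t₀ - t) ^ (2 - ρ)) 0 t₀ := by
      have := ((hasDerivAt_id t₀).const_sub t₀).rpow_const (p := 2 - ρ)
        (Or.inr (by linarith))
      refine this.congr_deriv ?_
      simp [Real.zero_rpow (show 2 - ρ - 1 ≠ 0 by linarith)]
    have h3 := (hasDerivAt_id t₀).const_sub t₀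
    have := ((hD.add (((h1.const_sub ((t₀ - a) ^ (1 - ρ))).div_const (1 - ρ)).const_mul
      (d t₀))).sub (h3.const_mul c)).add ((h2.div_const (2 - ρ)).const_mul K)
    refine this.congr_deriv ?_
    have : (1 - ρ) ≠ 0 := by linarith
    field_simp
    ring
  have hPt : P t₀ = N t₀ := by
    simp [hP, Real.zero_rpow (show 2 - ρ ≠ 0 by linarith)]
  have key : D - d t₀ * (t₀ - a) ^ (-ρ) + c ≤ 0 := by
    refine nonpos_of_hasDerivAt_of_le_left hP' ?_
    filter_upwards [Ioo_mem_nhdsLT (mem_Iio.1 hη), Ioo_mem_nhdsLT hat] with t ht hta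
    rw [hPt]
    have h0t : 0 < t := ha.trans_lt hta.1
    have i0 := hint t₀ ⟨ht0, le_rfl⟩
    have it := hint t ⟨h0t, hta.2.le⟩
    have sub {x y : ℝ} (u : ℝ) (hx : 0 ≤ x) (hxy : x ≤ y) (hyu : y ≤ u) :
        uIcc x y ⊆ uIcc 0 u := by
      rw [uIcc_of_le hxy, uIcc_of_le (hx.trans (hxy.trans hyu))]
      exact Icc_subset_Icc hx hyu
    have i01 := i0.mono_set (sub t₀ le_rfl ha hat.le)
    have i02 := i0.mono_set (sub t₀ ha hta.1.le hta.2.le)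
    have i03 := i0.mono_set (sub t₀ h0t.le hta.2.le le_rfl)
    have it1 := it.mono_set (sub t le_rfl ha hta.1.le)
    have it2 := it.mono_set (sub t ha hta.1.le le_rfl)
    have id1 := hd.mono_set (sub t₀ le_rfl ha hat.le)
    have hr : -1 < -ρ := by linarith
    have I1 : (∫ s in (0 : ℝ)..a, (t₀ - s) ^ (-ρ) * d s) - ∫ s in (0 : ℝ)..a, (t - s) ^ (-ρ) * d s
        ≤ -(c * (t₀ - t)) := by
      rw [← intervalIntegral.integral_sub i01 it1,
        show -(c * (t₀ - t)) = ∫ s in (0 : ℝ)..a, -(ρ * t₀ ^ (-ρ - 1)) * (t₀ - t) * d s by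
          rw [intervalIntegral.integral_const_mul, hc]; ring]
      refine intervalIntegral.integral_mono_on_of_le_Ioo ha (i01.sub it1) (id1.const_mul _) ?_
      intro s hs
      have := rpow_neg_sub_rpow_neg_le (ρ := ρ) (x := t₀ - s) (y := t - s) (t₀ := t₀) hρ0
        (by linarith [hs.2, hta.1]) (by linarith [hta.2]) (by linarith [hs.1])
      have h2 := mul_le_mul_of_nonneg_right this (hd0 s hs)
      nlinarith
    have I2 : (∫ s in a..t, (t₀ - s) ^ (-ρ) * d s) - ∫ s in a..t, (t - s) ^ (-ρ) * d s
        ≤ (∫ s in a..t, (t₀ - s) ^ (-ρ) * d t₀) - ∫ s in a..t, (t - s) ^ (-ρ) * d t₀ := by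
      have j1 := (intervalIntegrable_sub_rpow (a := a) (b := t) (t := t₀) hr).mul_const (d t₀)
      have j2 := (intervalIntegrable_sub_rpow (a := a) (b := t) (t := t) hr).mul_const (d t₀)
      rw [← intervalIntegral.integral_sub i02 it2, ← intervalIntegral.integral_sub j1 j2]
      refine intervalIntegral.integral_mono_on_of_le_Ioo hta.1.le (i02.sub it2) (j1.sub j2) ?_
      intro s hs
      have : (t₀ - s) ^ (-ρ) ≤ (t - s) ^ (-ρ) :=
        Real.rpow_le_rpow_of_nonpos (by linarith [hs.2]) (by linarith [hta.2]) (by linarith)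
      have h2 := hmin s ⟨hs.1, hs.2.trans hta.2⟩
      nlinarith
    have I3 : (∫ s in t..t₀, (t₀ - s) ^ (-ρ) * d s) ≤
        (∫ s in t..t₀, (t₀ - s) ^ (-ρ) * d t₀) + ∫ s in t..t₀, K * (t₀ - s) ^ (1 - ρ) := by
      have j1 := (intervalIntegrable_sub_rpow (a := t) (b := t₀) (t := t₀) hr).mul_const (d t₀)
      have j2 := (intervalIntegrable_sub_rpow (r := 1 - ρ) (a := t) (b := t₀) (t := t₀)
        (by linarith)).const_mul K
      rw [← intervalIntegral.integral_add j1 j2]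
      refine intervalIntegral.integral_mono_on_of_le_Ioo hta.2.le i03 (j1.add j2) ?_
      intro s hs
      have h4 : 0 < t₀ - s := by linarith [hs.2]
      have h5 : ‖d s - d t₀‖ ≤ K * ‖s - t₀‖ := hηK ⟨ht.1.trans hs.1, hs.2⟩
      rw [Real.norm_eq_abs, Real.norm_eq_abs, abs_sub_comm s, abs_of_pos h4] at h5
      have h6 := (le_abs_self _).trans h5
      rw [show 1 - ρ = -ρ + 1 by ring, Real.rpow_add_one h4.ne']
      have := mul_le_mul_of_nonneg_left h6 (Real.rpow_nonneg h4.le (-ρ))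
      nlinarith
    have E0 : N t₀ = (∫ s in (0 : ℝ)..a, (t₀ - s) ^ (-ρ) * d s) +
        (∫ s in a..t, (t₀ - s) ^ (-ρ) * d s) + ∫ s in t..t₀, (t₀ - s) ^ (-ρ) * d s := by
      rw [intervalIntegral.integral_add_adjacent_intervals i01 i02,
        intervalIntegral.integral_add_adjacent_intervals (i01.trans i02) i03]
      rfl
    have E1 : N t = (∫ s in (0 : ℝ)..a, (t - s) ^ (-ρ) * d s) +
        (∫ s in a..t, (t - s) ^ (-ρ) * d s) := by
      rw [intervalIntegral.integral_add_adjacent_intervals it1 it2]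
      rfl
    have E2 : (∫ s in a..t, (t₀ - s) ^ (-ρ)) + (∫ s in t..t₀, (t₀ - s) ^ (-ρ)) =
        (t₀ - a) ^ (1 - ρ) / (1 - ρ) := by
      rw [intervalIntegral.integral_add_adjacent_intervals (intervalIntegrable_sub_rpow hr)
        (intervalIntegrable_sub_rpow hr), integral_sub_rpow hr, show -ρ + 1 = 1 - ρ by ring]
    have E3 : (∫ s in a..t, (t - s) ^ (-ρ)) = (t - a) ^ (1 - ρ) / (1 - ρ) := by
      rw [integral_sub_rpow hr, show -ρ + 1 = 1 - ρ by ring]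
    have E4 : (∫ s in t..t₀, (t₀ - s) ^ (1 - ρ)) = (t₀ - t) ^ (2 - ρ) / (2 - ρ) := by
      rw [integral_sub_rpow (by linarith), show 1 - ρ + 1 = 2 - ρ by ring]
    simp only [intervalIntegral.integral_mul_const, intervalIntegral.integral_const_mul]
      at I2 I3
    have E5 : (∫ s in a..t, (t₀ - s) ^ (-ρ)) =
      (t₀ - a) ^ (1 - ρ) / (1 - ρ) - (∫ s in t..t₀, (t₀ - s) ^ (-ρ)) := by linarith
    rw [E5, E3] at I2
    rw [E4] at I3
    simp only [hP]
    rw [E0, E1, sub_div, mul_sub]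
    nlinarith
  linarith

/-- The comparison principle: a function that is positive near `0` and whose Riemann–Liouville
derivative is at least `-m` times the function stays positive. -/
lemma pos_of_deriv_volterra_ge {ρ : ℝ} (hρ0 : 0 < ρ) (hρ1 : ρ < 1) {d D : ℝ → ℝ} {m δ : ℝ}
    (hm : 0 ≤ m) (hδ : 0 < δ) (hpos : ∀ s ∈ Ioo 0 δ, 0 < d s)
    (hint : ∀ t, 0 < t → IntervalIntegrable (fun s => (t - s) ^ (-ρ) * d s) volume 0 t)
    (hd : ∀ t, 0 < t → IntervalIntegrable d volume 0 t)
    (hdiff : ∀ t, 0 < t → DifferentiableAt ℝ d t)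
    (hD : ∀ t, 0 < t → HasDerivAt (volterra (fun x => x ^ (-ρ)) d) (D t) t)
    (hDm : ∀ t, 0 < t → -m * d t ≤ D t) {t : ℝ} (ht : 0 < t) : 0 < d t := by
  by_contra! hneg
  have htδ : δ ≤ t := by
    by_contra! h
    exact absurd (hpos t ⟨ht, h⟩) (not_lt.2 hneg)
  -- the first point at which `d` fails to be positive
  have hcont : ContinuousOn d (Icc (δ / 2) t) := fun s hs =>
    (hdiff s (by linarith [hs.1])).continuousAt.continuousWithinAt
  have hcpt : IsCompact (Icc (δ / 2) t ∩ d ⁻¹' Iic 0) :=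
    isCompact_Icc.of_isClosed_subset (hcont.preimage_isClosed_of_isClosed isClosed_Icc isClosed_Iic)
      inter_subset_left
  obtain ⟨t₀, ⟨ht₀, hdt₀⟩, hleast⟩ := hcpt.exists_isLeast ⟨t, ⟨by linarith, le_rfl⟩, hneg⟩
  have ht0 : 0 < t₀ := by linarith [ht₀.1]
  have hbefore : ∀ s ∈ Ioo 0 t₀, 0 < d s := by
    intro s hs
    by_contra! h
    rcases lt_or_ge s δ with h1 | h1
    · exact absurd (hpos s ⟨hs.1, h1⟩) (not_lt.2 h)
    · have := hleast ⟨⟨by linarith, hs.2.le.trans ht₀.2⟩, h⟩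
      linarith [hs.2]
  have hdt : d t₀ ≤ 0 := hdt₀
  have h := deriv_volterra_rpow_neg_le hρ0 hρ1 (a := t₀ / 2) (by positivity) (by linarith)
    (fun t ht => hint t ht.1) (hd t₀ ht0) (fun s hs => (hbefore s ⟨hs.1, by linarith [hs.2]⟩).le)
    (fun s hs => hdt.trans (hbefore s ⟨by linarith [hs.1], hs.2⟩).le) (hdiff t₀ ht0) (hD t₀ ht0)
  have hI : 0 < ∫ s in (0 : ℝ)..(t₀ / 2), d s :=
    intervalIntegral.intervalIntegral_pos_of_pos_on (hd _ (by positivity))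
      (fun s hs => hbefore s ⟨hs.1, by linarith [hs.2]⟩) (by positivity)
  have h1 : (t₀ - t₀ / 2) ^ (-ρ) * d t₀ ≤ 0 :=
    mul_nonpos_of_nonneg_of_nonpos (Real.rpow_nonneg (by linarith) _) hdt
  have h2 : 0 < ρ * t₀ ^ (-ρ - 1) * ∫ s in (0 : ℝ)..(t₀ / 2), d s := by positivity
  have h3 := hDm t₀ ht0
  nlinarith

/-! ### The Mittag-Leffler function and the fundamental solution -/

lemma HasSum.congr_fun_value {f g : ℕ → ℝ} {a b : ℝ} (h : HasSum f a) (hf : ∀ n, g n = f n)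
    (ha : b = a) : HasSum g b := by
  rwa [funext hf, ha]

/-- The coefficients `1 / Γ(ρ(n + 1))` of the two-parameter Mittag-Leffler function `E_{ρ,ρ}`. -/
noncomputable def mlCoeff (ρ : ℝ) (n : ℕ) : ℝ := (Real.Gamma (ρ * (n + 1)))⁻¹

/-- The two-parameter Mittag-Leffler function `E_{ρ,ρ}(x) = ∑ₙ xⁿ / Γ(ρ(n + 1))`. -/
noncomputable def mittagLeffler (ρ x : ℝ) : ℝ := ∑' n : ℕ, mlCoeff ρ n * x ^ n

/-- The fundamental solution `t ^ (ρ - 1) E_{ρ,ρ}(-λ t ^ ρ)` of `∂_t^ρ y + λ y = 0`. -/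
noncomputable def mlKernel (ρ lam t : ℝ) : ℝ := t ^ (ρ - 1) * mittagLeffler ρ (-(lam * t ^ ρ))

lemma mlCoeff_pos {ρ : ℝ} (hρ0 : 0 < ρ) (n : ℕ) : 0 < mlCoeff ρ n :=
  inv_pos.2 (Real.Gamma_pos_of_pos (by positivity))

/-- The growth of the Gamma function over a step `ρ`, from its logarithmic convexity. -/
lemma Gamma_div_Gamma_add_le {ρ y : ℝ} (hρ0 : 0 < ρ) (hρ1 : ρ < 1) (hy : ρ ≤ y) :
    Real.Gamma y / Real.Gamma (y + ρ) ≤ 2 * y ^ (-ρ) := by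
  have hy0 : 0 < y := hρ0.trans_le hy
  -- `y + 1` lies between `y + ρ` and `y + ρ + 1`, with weights `ρ` and `1 - ρ`
  have h := Real.Gamma_mul_add_mul_le_rpow_Gamma_mul_rpow_Gamma (s := y + ρ) (t := y + ρ + 1)
    (a := ρ) (b := 1 - ρ) (by positivity) (by positivity) hρ0 (by linarith) (by ring)
  have hG : 0 < Real.Gamma (y + ρ) := Real.Gamma_pos_of_pos (by positivity)
  rw [show ρ * (y + ρ) + (1 - ρ) * (y + ρ + 1) = y + 1 by ring, Real.Gamma_add_one hy0.ne',
    Real.Gamma_add_one (by positivity), Real.mul_rpow (by positivity) hG.le] at h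
  have h2 : Real.Gamma (y + ρ) ^ ρ * ((y + ρ) ^ (1 - ρ) * Real.Gamma (y + ρ) ^ (1 - ρ)) =
      (y + ρ) ^ (1 - ρ) * Real.Gamma (y + ρ) := by
    rw [mul_left_comm, ← Real.rpow_add hG, show ρ + (1 - ρ) = 1 by ring, Real.rpow_one]
  rw [h2] at h
  have h3 : (y + ρ) ^ (1 - ρ) ≤ 2 * y ^ (1 - ρ) := by
    calc (y + ρ) ^ (1 - ρ) ≤ (2 * y) ^ (1 - ρ) :=
          Real.rpow_le_rpow (by positivity) (by linarith) (by linarith)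
      _ = 2 ^ (1 - ρ) * y ^ (1 - ρ) := Real.mul_rpow (by norm_num) hy0.le
      _ ≤ 2 * y ^ (1 - ρ) := by
          gcongr
          calc (2 : ℝ) ^ (1 - ρ) ≤ 2 ^ (1 : ℝ) :=
                Real.rpow_le_rpow_of_exponent_le (by norm_num) (by linarith)
            _ = 2 := Real.rpow_one 2
  rw [div_le_iff₀ hG]
  have h4 : y ^ (1 - ρ) = y * y ^ (-ρ) := by
    rw [sub_eq_add_neg, Real.rpow_add hy0, Real.rpow_one]
  have h5 : y * Real.Gamma y ≤ y * (2 * y ^ (-ρ) * Real.Gamma (y + ρ)) := by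
    calc y * Real.Gamma y ≤ (y + ρ) ^ (1 - ρ) * Real.Gamma (y + ρ) := h
      _ ≤ 2 * y ^ (1 - ρ) * Real.Gamma (y + ρ) := by gcongr
      _ = _ := by rw [h4]; ring
  exact le_of_mul_le_mul_left h5 hy0

lemma tendsto_mlCoeff_ratio {ρ : ℝ} (hρ0 : 0 < ρ) (hρ1 : ρ < 1) :
    Tendsto (fun n => ‖mlCoeff ρ n.succ‖ / ‖mlCoeff ρ n‖) atTop (𝓝 0) := by
  have h1 : Tendsto (fun n : ℕ => ρ * ((n : ℝ) + 1)) atTop atTop :=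
    (tendsto_natCast_atTop_atTop.atTop_add tendsto_const_nhds).const_mul_atTop hρ0
  have h2 : Tendsto (fun n : ℕ => 2 * (ρ * ((n : ℝ) + 1)) ^ (-ρ)) atTop (𝓝 0) := by
    simpa using ((tendsto_rpow_neg_atTop hρ0).comp h1).const_mul 2
  refine squeeze_zero (fun n => by positivity) (fun n => ?_) h2
  have h := Gamma_div_Gamma_add_le (y := ρ * ((n : ℝ) + 1)) hρ0 hρ1
    (by nlinarith [(Nat.cast_nonneg n : (0 : ℝ) ≤ n)])
  refine le_trans (le_of_eq ?_) h
  rw [Real.norm_of_nonneg (mlCoeff_pos hρ0 _).le, Real.norm_of_nonneg (mlCoeff_pos hρ0 _).le,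
    mlCoeff, mlCoeff, div_inv_eq_mul, mul_comm, ← div_eq_mul_inv]
  push_cast
  congr 2
  ring

lemma hasFPowerSeriesOnBall_mittagLeffler {ρ : ℝ} (hρ0 : 0 < ρ) (hρ1 : ρ < 1) :
    HasFPowerSeriesOnBall (mittagLeffler ρ) (FormalMultilinearSeries.ofScalars ℝ (mlCoeff ρ)) 0 ⊤ := by
  have hr : (FormalMultilinearSeries.ofScalars ℝ (mlCoeff ρ)).radius = ⊤ :=
    FormalMultilinearSeries.ofScalars_radius_eq_top_of_tendsto ℝ _
      (Eventually.of_forall fun n => (mlCoeff_pos hρ0 n).ne') (tendsto_mlCoeff_ratio hρ0 hρ1)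
  have h := (FormalMultilinearSeries.ofScalars ℝ (mlCoeff ρ)).hasFPowerSeriesOnBall (by simp [hr])
  rw [hr] at h
  convert h using 1
  ext x
  exact (FormalMultilinearSeries.ofScalars_sum_eq (mlCoeff ρ) x).symm

lemma hasSum_mittagLeffler {ρ : ℝ} (hρ0 : 0 < ρ) (hρ1 : ρ < 1) (x : ℝ) :
    HasSum (fun n => mlCoeff ρ n * x ^ n) (mittagLeffler ρ x) := by
  have h := (hasFPowerSeriesOnBall_mittagLeffler hρ0 hρ1).hasSum (y := x) (by simp)
  simpa [FormalMultilinearSeries.ofScalars_apply_eq, mul_comm] using h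

lemma differentiable_mittagLeffler {ρ : ℝ} (hρ0 : 0 < ρ) (hρ1 : ρ < 1) :
    Differentiable ℝ (mittagLeffler ρ) := by
  have h := (hasFPowerSeriesOnBall_mittagLeffler hρ0 hρ1).differentiableOn
  intro x
  exact (h x (by simp)).differentiableAt (by simp)

lemma continuous_mittagLeffler {ρ : ℝ} (hρ0 : 0 < ρ) (hρ1 : ρ < 1) :
    Continuous (mittagLeffler ρ) := (differentiable_mittagLeffler hρ0 hρ1).continuous

lemma hasDerivAt_mittagLeffler_zero {ρ : ℝ} (hρ0 : 0 < ρ) (hρ1 : ρ < 1) :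
    HasDerivAt (mittagLeffler ρ) (mlCoeff ρ 1) 0 := by
  have h := (hasFPowerSeriesOnBall_mittagLeffler hρ0 hρ1).hasFPowerSeriesAt.hasDerivAt
  simpa [FormalMultilinearSeries.ofScalars_apply_eq] using h

lemma mittagLeffler_zero {ρ : ℝ} (hρ0 : 0 < ρ) (hρ1 : ρ < 1) :
    mittagLeffler ρ 0 = (Real.Gamma ρ)⁻¹ := by
  have h := hasSum_mittagLeffler hρ0 hρ1 0
  have h2 := hasSum_ite_eq (0 : ℕ) (mlCoeff ρ 0)
  have : (fun n : ℕ => mlCoeff ρ n * (0 : ℝ) ^ n) = fun n => if n = 0 then mlCoeff ρ 0 else 0 := by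
    ext n
    rcases n with _ | n <;> simp
  rw [this] at h
  rw [h.unique h2]
  simp [mlCoeff]

lemma summable_pow_div_Gamma {ρ : ℝ} (hρ0 : 0 < ρ) (hρ1 : ρ < 1) {x : ℝ} (hx : 0 ≤ x) :
    Summable fun n : ℕ => x ^ n / Real.Gamma (ρ * n + 1) := by
  rw [← summable_nat_add_iff 1]
  refine Summable.of_nonneg_of_le (fun n => ?_) (fun n => ?_)
    ((hasSum_mittagLeffler hρ0 hρ1 x).summable.mul_left (x / ρ))
  · have := Real.Gamma_pos_of_pos (show 0 < ρ * ((n + 1 : ℕ) : ℝ) + 1 by positivity)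
    positivity
  · have hG := Real.Gamma_pos_of_pos (show 0 < ρ * ((n : ℝ) + 1) by positivity)
    push_cast
    rw [Real.Gamma_add_one (by positivity), mlCoeff, pow_succ]
    calc x ^ n * x / (ρ * (n + 1) * Real.Gamma (ρ * (n + 1)))
        ≤ x ^ n * x / (ρ * 1 * Real.Gamma (ρ * (n + 1))) := by
          gcongr
          linarith [(Nat.cast_nonneg n : (0 : ℝ) ≤ n)]
      _ = _ := by field_simp

lemma mlKernel_hasSum {ρ : ℝ} (hρ0 : 0 < ρ) (hρ1 : ρ < 1) (lam : ℝ) {s : ℝ} (hs : 0 < s) :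
    HasSum (fun n : ℕ => (-lam) ^ n * mlCoeff ρ n * s ^ (ρ * (n + 1) - 1)) (mlKernel ρ lam s) := by
  have h := (hasSum_mittagLeffler hρ0 hρ1 (-(lam * s ^ ρ))).mul_left (s ^ (ρ - 1))
  refine h.congr_fun_value (fun n => ?_) rfl
  rw [show ρ * ((n : ℝ) + 1) - 1 = (ρ - 1) + ρ * n by ring, Real.rpow_add hs, Real.rpow_mul_natCast
    hs.le, ← neg_mul, mul_pow]
  ring

lemma continuous_mittagLeffler_rpow {ρ : ℝ} (hρ0 : 0 < ρ) (hρ1 : ρ < 1) (lam : ℝ) :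
    Continuous fun s : ℝ => mittagLeffler ρ (-(lam * s ^ ρ)) :=
  (continuous_mittagLeffler hρ0 hρ1).comp
    (continuous_const.mul (Real.continuous_rpow_const hρ0.le)).neg

lemma measurable_mlKernel {ρ : ℝ} (hρ0 : 0 < ρ) (hρ1 : ρ < 1) (lam : ℝ) :
    Measurable (mlKernel ρ lam) :=
  (measurable_id.pow_const _).mul (continuous_mittagLeffler_rpow hρ0 hρ1 lam).measurable

lemma intervalIntegrable_mlKernel {ρ : ℝ} (hρ0 : 0 < ρ) (hρ1 : ρ < 1) (lam t : ℝ) :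
    IntervalIntegrable (mlKernel ρ lam) volume 0 t :=
  (intervalIntegral.intervalIntegrable_rpow' (by linarith)).mul_continuousOn
    (continuous_mittagLeffler_rpow hρ0 hρ1 lam).continuousOn

lemma intervalIntegrable_rpow_neg_mul_mlKernel {ρ : ℝ} (hρ0 : 0 < ρ) (hρ1 : ρ < 1) (lam : ℝ)
    {t : ℝ} (ht : 0 < t) :
    IntervalIntegrable (fun s => (t - s) ^ (-ρ) * mlKernel ρ lam s) volume 0 t := by
  have h := (intervalIntegrable_rpow_mul_rpow (a := 1 - ρ) (b := ρ) (by linarith) hρ0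
    ht).mul_continuousOn (continuous_mittagLeffler_rpow hρ0 hρ1 lam).continuousOn
  rw [show 1 - ρ - 1 = -ρ by ring] at h
  simpa only [mlKernel, mul_assoc] using h

lemma differentiableAt_mlKernel {ρ : ℝ} (hρ0 : 0 < ρ) (hρ1 : ρ < 1) (lam : ℝ) {t : ℝ} (ht : 0 < t) :
    DifferentiableAt ℝ (mlKernel ρ lam) t := by
  have h1 := (Real.hasDerivAt_rpow_const (x := t) (p := ρ - 1) (Or.inl ht.ne')).differentiableAt
  have h2 := (Real.hasDerivAt_rpow_const (x := t) (p := ρ) (Or.inl ht.ne')).differentiableAt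
  exact h1.mul (((differentiable_mittagLeffler hρ0 hρ1) _).comp t ((h2.const_mul lam).neg))

/-- The integrated form of `∂_t^ρ e + λ e = 0`, `∂_t^(ρ-1) e (0) = 1`, for `e = mlKernel ρ λ`,
obtained by integrating the power series term by term. -/
lemma volterra_rpow_neg_mlKernel {ρ : ℝ} (hρ0 : 0 < ρ) (hρ1 : ρ < 1) (lam : ℝ) {t : ℝ}
    (ht : 0 < t) :
    volterra (fun x => x ^ (-ρ)) (mlKernel ρ lam) t =
      Real.Gamma (1 - ρ) * (1 - lam * ∫ s in (0 : ℝ)..t, mlKernel ρ lam s) := by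
  have hGρ : 0 < Real.Gamma (1 - ρ) := Real.Gamma_pos_of_pos (by linarith)
  set B : ℕ → ℝ := fun n => (-(lam * t ^ ρ)) ^ n / Real.Gamma (ρ * n + 1) with hB
  have hpow (n : ℕ) : t ^ (ρ * n) = (t ^ ρ) ^ n := Real.rpow_mul_natCast ht.le _ _
  have habs := summable_pow_div_Gamma hρ0 hρ1 (x := |lam| * t ^ ρ) (by positivity)
  have hG (n : ℕ) : 0 < Real.Gamma (ρ * n + 1) := Real.Gamma_pos_of_pos (by positivity)
  -- the convolution with `t ^ (-ρ)`
  have h1 : HasSum (fun n => Real.Gamma (1 - ρ) * B n)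
      (volterra (fun x => x ^ (-ρ)) (mlKernel ρ lam) t) := by
    have hJ (n : ℕ) : mlCoeff ρ n * ∫ s in (0 : ℝ)..t, (t - s) ^ (1 - ρ - 1) * s ^ (ρ * (n + 1) - 1) =
        Real.Gamma (1 - ρ) * ((t ^ ρ) ^ n / Real.Gamma (ρ * n + 1)) := by
      rw [integral_rpow_mul_rpow (by linarith) (by positivity) ht, mlCoeff, ← hpow]
      have := Real.Gamma_pos_of_pos (show 0 < ρ * ((n : ℝ) + 1) by positivity)
      rw [show 1 - ρ + ρ * ((n : ℝ) + 1) = ρ * n + 1 by ring, show ρ * (n : ℝ) + 1 - 1 = ρ * n by ring]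
      field_simp
    have hi (n : ℕ) := (intervalIntegrable_iff_integrableOn_Ioc_of_le ht.le).1
      (intervalIntegrable_rpow_mul_rpow (a := 1 - ρ) (b := ρ * (n + 1)) (by linarith)
        (by positivity) ht)
    have hs := hasSum_integral_of_summable_integral_norm (μ := volume.restrict (Ioc 0 t))
      (F := fun (n : ℕ) s => ((-lam) ^ n * mlCoeff ρ n) *
        ((t - s) ^ (1 - ρ - 1) * s ^ (ρ * (n + 1) - 1))) (fun n => (hi n).const_mul _) ?_
    · refine hs.congr_fun_value (fun n => ?_) ?_
      · rw [integral_const_mul, ← intervalIntegral.integral_of_le ht.le, mul_assoc, hJ, hB]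
        simp only
        rw [← neg_mul, mul_pow]
        ring
      · rw [volterra, intervalIntegral.integral_of_le ht.le]
        refine setIntegral_congr_fun measurableSet_Ioc fun s hs => ?_
        have := (mlKernel_hasSum hρ0 hρ1 lam hs.1).mul_left ((t - s) ^ (-ρ))
        simp only [smul_eq_mul]
        rw [← this.tsum_eq]
        refine tsum_congr fun n => ?_
        rw [show 1 - ρ - 1 = -ρ by ring]
        ring
    · refine (habs.mul_left (Real.Gamma (1 - ρ))).congr fun n => ?_
      have : ∀ s ∈ Ioc 0 t, ‖((-lam) ^ n * mlCoeff ρ n) *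
          ((t - s) ^ (1 - ρ - 1) * s ^ (ρ * ((n : ℝ) + 1) - 1))‖ = |lam| ^ n * mlCoeff ρ n *
          ((t - s) ^ (1 - ρ - 1) * s ^ (ρ * ((n : ℝ) + 1) - 1)) := by
        intro s hs
        have h1 : 0 ≤ t - s := by linarith [hs.2]
        rw [norm_mul, Real.norm_of_nonneg (mul_nonneg (Real.rpow_nonneg h1 _)
          (Real.rpow_nonneg hs.1.le _)), norm_mul, Real.norm_of_nonneg (mlCoeff_pos hρ0 n).le,
          norm_pow, norm_neg, Real.norm_eq_abs]
      rw [setIntegral_congr_fun measurableSet_Ioc this, integral_const_mul,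
        ← intervalIntegral.integral_of_le ht.le, mul_assoc, hJ, mul_pow]
      ring
  -- the plain integral
  have h2 : HasSum (fun n => -B (n + 1)) (lam * ∫ s in (0 : ℝ)..t, mlKernel ρ lam s) := by
    have hJ (n : ℕ) : mlCoeff ρ n * ∫ s in (0 : ℝ)..t, s ^ (ρ * ((n : ℝ) + 1) - 1) =
        (t ^ ρ) ^ (n + 1) / Real.Gamma (ρ * ((n + 1 : ℕ) : ℝ) + 1) := by
      have h0 : 0 < ρ * ((n : ℝ) + 1) := by positivity
      have := Real.Gamma_pos_of_pos h0
      rw [integral_rpow (Or.inl (by linarith)), sub_add_cancel, Real.zero_rpow h0.ne', mlCoeff, ← hpow]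
      push_cast
      rw [Real.Gamma_add_one h0.ne', sub_zero]
      field_simp
    have hi (n : ℕ) := (intervalIntegrable_iff_integrableOn_Ioc_of_le ht.le).1
      (intervalIntegral.intervalIntegrable_rpow' (a := 0) (b := t) (r := ρ * ((n : ℝ) + 1) - 1)
        (by linarith [show 0 < ρ * ((n : ℝ) + 1) by positivity]))
    have hs := hasSum_integral_of_summable_integral_norm (μ := volume.restrict (Ioc 0 t))
      (F := fun (n : ℕ) s => ((-lam) ^ n * mlCoeff ρ n) * s ^ (ρ * ((n : ℝ) + 1) - 1))
      (fun n => (hi n).const_mul _) ?_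
    · refine (hs.mul_left lam).congr_fun_value (fun n => ?_) ?_
      · rw [integral_const_mul, ← intervalIntegral.integral_of_le ht.le, mul_assoc, hJ, hB]
        simp only
        rw [← neg_mul, mul_pow, pow_succ (-lam)]
        ring
      · rw [intervalIntegral.integral_of_le ht.le]
        congr 1
        refine setIntegral_congr_fun measurableSet_Ioc fun s hs => ?_
        exact (mlKernel_hasSum hρ0 hρ1 lam hs.1).tsum_eq.symm
    · rcases eq_or_ne lam 0 with rfl | hlam
      · refine summable_of_ne_finset_zero (s := {0}) fun n hn => ?_
        simp [zero_pow (Finset.notMem_singleton.1 hn)]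
      · refine (((summable_nat_add_iff 1).2 habs).mul_left (|lam|⁻¹)).congr fun n => ?_
        have : ∀ s ∈ Ioc 0 t, ‖((-lam) ^ n * mlCoeff ρ n) * s ^ (ρ * ((n : ℝ) + 1) - 1)‖ =
            |lam| ^ n * mlCoeff ρ n * s ^ (ρ * ((n : ℝ) + 1) - 1) := by
          intro s hs
          rw [norm_mul, Real.norm_of_nonneg (Real.rpow_nonneg hs.1.le _), norm_mul,
            Real.norm_of_nonneg (mlCoeff_pos hρ0 n).le, norm_pow, norm_neg, Real.norm_eq_abs]
        have hl : 0 < |lam| := abs_pos.2 hlam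
        rw [setIntegral_congr_fun measurableSet_Ioc this, integral_const_mul,
          ← intervalIntegral.integral_of_le ht.le, mul_assoc, hJ, mul_pow, pow_succ |lam|]
        field_simp
  have hBs : HasSum B ((Real.Gamma (1 - ρ))⁻¹ *
      volterra (fun x => x ^ (-ρ)) (mlKernel ρ lam) t) := by
    refine (h1.mul_left (Real.Gamma (1 - ρ))⁻¹).congr_fun_value (fun n => ?_) rfl
    field_simp
  have h3 := (hasSum_nat_add_iff' 1).2 hBs
  have h4 := h2.neg
  simp only [neg_neg] at h4
  have h5 := h3.unique h4
  simp only [Finset.range_one, Finset.sum_singleton, hB, pow_zero, Nat.cast_zero, mul_zero,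
    zero_add, Real.Gamma_one, div_one] at h5
  field_simp at h5
  linarith

lemma continuousAt_mlKernel {ρ : ℝ} (hρ0 : 0 < ρ) (hρ1 : ρ < 1) (lam : ℝ) {t : ℝ} (ht : 0 < t) :
    ContinuousAt (mlKernel ρ lam) t := (differentiableAt_mlKernel hρ0 hρ1 lam ht).continuousAt

lemma hasDerivAt_volterra_mlKernel {ρ : ℝ} (hρ0 : 0 < ρ) (hρ1 : ρ < 1) (lam : ℝ) {t : ℝ}
    (ht : 0 < t) : HasDerivAt (volterra (fun x => x ^ (-ρ)) (mlKernel ρ lam))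
      (-(Real.Gamma (1 - ρ) * lam) * mlKernel ρ lam t) t := by
  have h := intervalIntegral.integral_hasDerivAt_right (intervalIntegrable_mlKernel hρ0 hρ1 lam t)
    ((measurable_mlKernel hρ0 hρ1 lam).stronglyMeasurable.stronglyMeasurableAtFilter)
    (continuousAt_mlKernel hρ0 hρ1 lam ht)
  have h2 := ((h.const_mul lam).const_sub 1).const_mul (Real.Gamma (1 - ρ))
  refine (h2.congr_of_eventuallyEq ?_).congr_deriv (by ring)
  filter_upwards [lt_mem_nhds ht] with s hs
  exact volterra_rpow_neg_mlKernel hρ0 hρ1 lam hs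

/-! ### Positivity and two-sided bounds of the Mittag-Leffler function -/

lemma mlKernel_one (ρ x : ℝ) : mlKernel ρ x 1 = mittagLeffler ρ (-x) := by
  simp [mlKernel]

lemma mlKernel_pos {ρ : ℝ} (hρ0 : 0 < ρ) (hρ1 : ρ < 1) {lam t : ℝ} (hlam : 0 ≤ lam) (ht : 0 < t) :
    0 < mlKernel ρ lam t := by
  have hnear : ∀ᶠ s in 𝓝 (0 : ℝ), 0 < mittagLeffler ρ (-(lam * s ^ ρ)) := by
    refine (continuous_mittagLeffler_rpow hρ0 hρ1 lam).continuousAt.eventually_const_lt ?_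
    simp only [Real.zero_rpow hρ0.ne', mul_zero, neg_zero, mittagLeffler_zero hρ0 hρ1]
    exact inv_pos.2 (Real.Gamma_pos_of_pos hρ0)
  obtain ⟨δ, hδ, hball⟩ := Metric.eventually_nhds_iff.1 hnear
  have hG : 0 < Real.Gamma (1 - ρ) := Real.Gamma_pos_of_pos (by linarith)
  refine pos_of_deriv_volterra_ge hρ0 hρ1 (m := Real.Gamma (1 - ρ) * lam) (by positivity) hδ
    (fun s hs => ?_) (fun t ht => intervalIntegrable_rpow_neg_mul_mlKernel hρ0 hρ1 lam ht)
    (fun t _ => intervalIntegrable_mlKernel hρ0 hρ1 lam t)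
    (fun t ht => differentiableAt_mlKernel hρ0 hρ1 lam ht)
    (fun t ht => hasDerivAt_volterra_mlKernel hρ0 hρ1 lam ht) (fun t _ => le_rfl) ht
  refine mul_pos (Real.rpow_pos_of_pos hs.1 _) (hball ?_)
  rw [Real.dist_eq, sub_zero, abs_of_pos hs.1]
  exact hs.2

lemma mittagLeffler_neg_pos {ρ : ℝ} (hρ0 : 0 < ρ) (hρ1 : ρ < 1) {x : ℝ} (hx : 0 ≤ x) :
    0 < mittagLeffler ρ (-x) := by
  rw [← mlKernel_one]
  exact mlKernel_pos hρ0 hρ1 hx one_pos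

/-- The difference of the kernels for `lam < mu` is positive by the comparison principle: its
Riemann–Liouville derivative is `-lam` times the difference plus `(mu - lam) * mlKernel ρ mu`. -/
lemma mlKernel_lt {ρ : ℝ} (hρ0 : 0 < ρ) (hρ1 : ρ < 1) {lam mu t : ℝ} (hlam : 0 ≤ lam)
    (hlm : lam < mu) (ht : 0 < t) : mlKernel ρ mu t < mlKernel ρ lam t := by
  have hG : 0 < Real.Gamma (1 - ρ) := Real.Gamma_pos_of_pos (by linarith)
  have hnear : ∀ᶠ y in 𝓝[>] (0 : ℝ), 0 < mittagLeffler ρ (-(lam * y)) - mittagLeffler ρ (-(mu * y)) := by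
    have hd (l : ℝ) : HasDerivAt (fun y => mittagLeffler ρ (-(l * y))) (mlCoeff ρ 1 * -l) 0 := by
      have h0 : HasDerivAt (mittagLeffler ρ) (mlCoeff ρ 1) (-(l * 0)) := by
        simpa using hasDerivAt_mittagLeffler_zero hρ0 hρ1
      have h1 : HasDerivAt (fun y : ℝ => -(l * y)) (-l) 0 := by
        simpa using (hasDerivAt_id (0 : ℝ)).const_mul l |>.fun_neg
      exact h0.comp (0 : ℝ) h1
    have h2 := hasDerivAt_iff_tendsto_slope.1 ((hd lam).sub (hd mu))
    have h3 : 0 < mlCoeff ρ 1 * -lam - mlCoeff ρ 1 * -mu := by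
      nlinarith [mlCoeff_pos hρ0 1]
    have h4 := (h2.mono_left (nhdsWithin_mono (0 : ℝ)
      (fun x (hx : 0 < x) => hx.ne'))).eventually_const_lt h3
    filter_upwards [h4, self_mem_nhdsWithin] with y hy hy0
    rw [slope_def_field] at hy
    simp only [Pi.sub_apply, mul_zero, sub_self, sub_zero] at hy
    have := mul_pos hy (mem_Ioi.1 hy0)
    rwa [div_mul_cancel₀ _ (mem_Ioi.1 hy0).ne'] at this
  have htend : Tendsto (fun s : ℝ => s ^ ρ) (𝓝[>] 0) (𝓝[>] 0) := by
    refine tendsto_nhdsWithin_iff.2 ⟨?_, ?_⟩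
    · have := (Real.continuous_rpow_const hρ0.le).tendsto (0 : ℝ)
      rw [Real.zero_rpow hρ0.ne'] at this
      exact this.mono_left nhdsWithin_le_nhds
    · filter_upwards [self_mem_nhdsWithin] with s hs using Real.rpow_pos_of_pos hs _
  obtain ⟨δ, hδ, hsub⟩ := mem_nhdsGT_iff_exists_Ioo_subset.1 (htend.eventually hnear)
  suffices h : 0 < mlKernel ρ lam t - mlKernel ρ mu t by linarith
  have hi (l : ℝ) {t : ℝ} (ht : 0 < t) := intervalIntegrable_rpow_neg_mul_mlKernel hρ0 hρ1 l ht
  refine pos_of_deriv_volterra_ge hρ0 hρ1 (d := fun s => mlKernel ρ lam s - mlKernel ρ mu s)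
    (m := Real.Gamma (1 - ρ) * lam) (by positivity) (mem_Ioi.1 hδ)
    (D := fun t => -(Real.Gamma (1 - ρ) * lam) * mlKernel ρ lam t -
      -(Real.Gamma (1 - ρ) * mu) * mlKernel ρ mu t)
    (fun s hs => ?_) (fun t ht => ?_)
    (fun t _ => (intervalIntegrable_mlKernel hρ0 hρ1 lam t).sub
      (intervalIntegrable_mlKernel hρ0 hρ1 mu t))
    (fun t ht => (differentiableAt_mlKernel hρ0 hρ1 lam ht).sub (differentiableAt_mlKernel hρ0 hρ1 mu ht))
    (fun t ht => ?_) (fun t ht => ?_) ht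
  · have : 0 < mittagLeffler ρ (-(lam * s ^ ρ)) - mittagLeffler ρ (-(mu * s ^ ρ)) := hsub hs
    simp only [mlKernel]
    rw [← mul_sub]
    exact mul_pos (Real.rpow_pos_of_pos hs.1 _) this
  · simpa only [mul_sub] using (hi lam ht).sub (hi mu ht)
  · refine ((hasDerivAt_volterra_mlKernel hρ0 hρ1 lam ht).sub
      (hasDerivAt_volterra_mlKernel hρ0 hρ1 mu ht)).congr_of_eventuallyEq ?_
    filter_upwards [lt_mem_nhds ht] with s hs
    simp only [volterra, smul_eq_mul, Pi.sub_apply, mul_sub]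
    exact intervalIntegral.integral_sub (hi lam hs) (hi mu hs)
  · have := mlKernel_pos hρ0 hρ1 (hlam.trans hlm.le) ht
    have h2 : 0 < Real.Gamma (1 - ρ) * (mu - lam) * mlKernel ρ mu t := by
      have : 0 < mu - lam := by linarith
      positivity
    nlinarith

lemma mittagLeffler_neg_le {ρ : ℝ} (hρ0 : 0 < ρ) (hρ1 : ρ < 1) {x y : ℝ} (hx : 0 ≤ x)
    (hxy : x ≤ y) : mittagLeffler ρ (-y) ≤ mittagLeffler ρ (-x) := by
  rcases eq_or_lt_of_le hxy with rfl | h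
  · exact le_rfl
  · rw [← mlKernel_one, ← mlKernel_one]
    exact (mlKernel_lt hρ0 hρ1 hx h one_pos).le

lemma mittagLeffler_neg_le_inv_Gamma {ρ : ℝ} (hρ0 : 0 < ρ) (hρ1 : ρ < 1) {x : ℝ} (hx : 0 ≤ x) :
    mittagLeffler ρ (-x) ≤ (Real.Gamma ρ)⁻¹ := by
  rw [← mittagLeffler_zero hρ0 hρ1, ← neg_zero]
  exact mittagLeffler_neg_le hρ0 hρ1 le_rfl hx

/-- On `[0, t]` the kernel is bounded below by its leading singularity times the smallest value
of the Mittag-Leffler factor. -/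
lemma le_integral_mlKernel {ρ : ℝ} (hρ0 : 0 < ρ) (hρ1 : ρ < 1) {lam t : ℝ} (hlam : 0 ≤ lam)
    (ht : 0 < t) : t ^ ρ / ρ * mittagLeffler ρ (-(lam * t ^ ρ)) ≤
      ∫ s in (0 : ℝ)..t, mlKernel ρ lam s := by
  have h1 : ∫ s in (0 : ℝ)..t, s ^ (ρ - 1) = t ^ ρ / ρ := by
    rw [integral_rpow (Or.inl (by linarith)), sub_add_cancel, Real.zero_rpow hρ0.ne', sub_zero]
  rw [← h1, ← intervalIntegral.integral_mul_const]
  refine intervalIntegral.integral_mono_on_of_le_Ioo ht.le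
    ((intervalIntegral.intervalIntegrable_rpow' (by linarith)).mul_const _)
    (intervalIntegrable_mlKernel hρ0 hρ1 lam t) fun s hs => ?_
  refine mul_le_mul_of_nonneg_left ?_ (Real.rpow_nonneg hs.1.le _)
  refine mittagLeffler_neg_le hρ0 hρ1 (mul_nonneg hlam (Real.rpow_nonneg hs.1.le _)) ?_
  exact mul_le_mul_of_nonneg_left (Real.rpow_le_rpow hs.1.le hs.2.le hρ0.le) hlam

lemma volterra_rpow_neg_mlKernel_nonneg {ρ : ℝ} (hρ0 : 0 < ρ) (hρ1 : ρ < 1) {lam t : ℝ}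
    (hlam : 0 ≤ lam) (ht : 0 < t) : 0 ≤ volterra (fun x => x ^ (-ρ)) (mlKernel ρ lam) t := by
  refine intervalIntegral.integral_nonneg ht.le fun s hs => ?_
  rcases eq_or_lt_of_le hs.1 with h | h
  · simp [← h, mlKernel, Real.zero_rpow (show ρ - 1 ≠ 0 by linarith)]
  · exact mul_nonneg (Real.rpow_nonneg (by linarith [hs.2]) _) (mlKernel_pos hρ0 hρ1 hlam h).le

/-- The decay of `E_{ρ,ρ}` on the negative axis, a consequence of `λ ∫₀¹ e_λ ≤ 1`. -/
lemma mul_mittagLeffler_neg_le {ρ : ℝ} (hρ0 : 0 < ρ) (hρ1 : ρ < 1) {x : ℝ} (hx : 0 ≤ x) :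
    x * mittagLeffler ρ (-x) ≤ ρ := by
  have hG : 0 < Real.Gamma (1 - ρ) := Real.Gamma_pos_of_pos (by linarith)
  have h1 := volterra_rpow_neg_mlKernel_nonneg hρ0 hρ1 hx one_pos
  rw [volterra_rpow_neg_mlKernel hρ0 hρ1 x one_pos] at h1
  have h2 := nonneg_of_mul_nonneg_right h1 hG
  have h3 := le_integral_mlKernel hρ0 hρ1 hx one_pos
  rw [Real.one_rpow, mul_one] at h3
  have h4 := mul_le_mul_of_nonneg_left h3 hx
  have h5 : x * (1 / ρ * mittagLeffler ρ (-x)) ≤ 1 := by linarith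
  calc x * mittagLeffler ρ (-x) = ρ * (x * (1 / ρ * mittagLeffler ρ (-x))) := by field_simp
    _ ≤ ρ * 1 := by gcongr
    _ = ρ := mul_one ρ

/-- `E_{ρ,ρ}(-x)` decays no faster than `x ^ (-2)`. For `x ≥ 1` this is the extremum principle at the
point `1` for the decreasing function `mlKernel ρ x`, whose integral over `[0, 1/2]` is at least a
multiple of `1 / x`. -/
lemma exists_le_sq_mul_mittagLeffler_neg {ρ : ℝ} (hρ0 : 0 < ρ) (hρ1 : ρ < 1) :
    ∃ c : ℝ, 0 < c ∧ ∀ x : ℝ, 0 ≤ x → c ≤ (1 + x) ^ 2 * mittagLeffler ρ (-x) := by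
  have hG : 0 < Real.Gamma (1 - ρ) := Real.Gamma_pos_of_pos (by linarith)
  have hE1 := mittagLeffler_neg_pos hρ0 hρ1 zero_le_one
  set c₁ := mittagLeffler ρ (-1) * (1 / 2) ^ ρ / (Real.Gamma (1 - ρ) + (1 / 2) ^ (-ρ)) with hc₁
  have hc₁0 : 0 < c₁ := by positivity
  refine ⟨min (mittagLeffler ρ (-1)) c₁, lt_min hE1 hc₁0, fun x hx => ?_⟩
  have hEx := mittagLeffler_neg_pos hρ0 hρ1 hx
  rcases le_total x 1 with h | h
  · refine (min_le_left _ _).trans ((mittagLeffler_neg_le hρ0 hρ1 hx h).trans ?_)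
    exact le_mul_of_one_le_left hEx.le (by nlinarith)
  refine (min_le_right _ _).trans ?_
  have hx0 : 0 < x := by linarith
  have hdec : ∀ s ∈ Ioo (1 / 2 : ℝ) 1, mlKernel ρ x 1 ≤ mlKernel ρ x s := by
    intro s hs
    have hs0 : 0 < s := by linarith [hs.1]
    rw [mlKernel_one]
    have h1 : 1 ≤ s ^ (ρ - 1) :=
      Real.one_le_rpow_of_pos_of_le_one_of_nonpos hs0 hs.2.le (by linarith)
    have h2 : mittagLeffler ρ (-x) ≤ mittagLeffler ρ (-(x * s ^ ρ)) := by
      refine mittagLeffler_neg_le hρ0 hρ1 (by positivity) ?_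
      exact mul_le_of_le_one_right hx (Real.rpow_le_one hs0.le hs.2.le hρ0.le)
    calc mittagLeffler ρ (-x) ≤ 1 * mittagLeffler ρ (-(x * s ^ ρ)) := by linarith
      _ ≤ _ := mul_le_mul_of_nonneg_right h1 (hEx.le.trans h2)
  have hmain := deriv_volterra_rpow_neg_le hρ0 hρ1 (a := 1 / 2) (t₀ := 1) (by norm_num) (by norm_num)
    (fun t ht => intervalIntegrable_rpow_neg_mul_mlKernel hρ0 hρ1 x ht.1)
    (intervalIntegrable_mlKernel hρ0 hρ1 x 1)
    (fun s hs => (mlKernel_pos hρ0 hρ1 hx hs.1).le) hdec (differentiableAt_mlKernel hρ0 hρ1 x one_pos)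
    (hasDerivAt_volterra_mlKernel hρ0 hρ1 x one_pos)
  rw [mlKernel_one, Real.one_rpow, mul_one, show (1 : ℝ) - 1 / 2 = 1 / 2 by norm_num] at hmain
  -- the part of the integral on which `x * s ^ ρ ≤ 1`
  set s₁ : ℝ := 1 / 2 * x ^ (-(1 / ρ)) with hs₁
  have hs₁0 : 0 < s₁ := by positivity
  have hs₁h : s₁ ≤ 1 / 2 := by
    have : x ^ (-(1 / ρ)) ≤ 1 :=
      Real.rpow_le_one_of_one_le_of_nonpos h (by rw [neg_nonpos]; positivity)
    linarith
  have hs₁ρ : s₁ ^ ρ = (1 / 2) ^ ρ * x⁻¹ := by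
    rw [hs₁, Real.mul_rpow (by norm_num) (by positivity), ← Real.rpow_mul hx,
      show -(1 / ρ) * ρ = -1 by field_simp, Real.rpow_neg_one]
  have hI : (1 / 2) ^ ρ * x⁻¹ / ρ * mittagLeffler ρ (-1) ≤
      ∫ s in (0 : ℝ)..(1 / 2), mlKernel ρ x s := by
    have h1 := le_integral_mlKernel hρ0 hρ1 hx hs₁0
    have h2 : ∫ s in (0 : ℝ)..s₁, mlKernel ρ x s ≤ ∫ s in (0 : ℝ)..(1 / 2), mlKernel ρ x s := by
      refine intervalIntegral.integral_mono_interval le_rfl hs₁0.le hs₁h ?_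
        (intervalIntegrable_mlKernel hρ0 hρ1 x _)
      filter_upwards [ae_restrict_mem measurableSet_Ioc] with s hs
      exact (mlKernel_pos hρ0 hρ1 hx hs.1).le
    have h3 : mittagLeffler ρ (-1) ≤ mittagLeffler ρ (-(x * s₁ ^ ρ)) := by
      refine mittagLeffler_neg_le hρ0 hρ1 (by positivity) ?_
      rw [hs₁ρ, mul_left_comm, mul_inv_cancel₀ hx0.ne', mul_one]
      exact Real.rpow_le_one (by norm_num) (by norm_num) hρ0.le
    rw [← hs₁ρ]
    exact (mul_le_mul_of_nonneg_left h3 (by positivity)).trans (h1.trans h2)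
  have h5 := mul_le_mul_of_nonneg_left hI hρ0.le
  have h6 : ρ * ((1 / 2) ^ ρ * x⁻¹ / ρ * mittagLeffler ρ (-1)) =
      mittagLeffler ρ (-1) * (1 / 2) ^ ρ * x⁻¹ := by field_simp
  rw [h6] at h5
  have hp : (0 : ℝ) < (1 / 2) ^ (-ρ) := by positivity
  have h7 : mittagLeffler ρ (-1) * (1 / 2) ^ ρ * x⁻¹ ≤
      (Real.Gamma (1 - ρ) * x + (1 / 2) ^ (-ρ)) * mittagLeffler ρ (-x) := by linarith
  have h8 : mittagLeffler ρ (-1) * (1 / 2) ^ ρ ≤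
      x * ((Real.Gamma (1 - ρ) * x + (1 / 2) ^ (-ρ)) * mittagLeffler ρ (-x)) := by
    have := mul_le_mul_of_nonneg_left h7 hx
    rwa [mul_left_comm, mul_inv_cancel₀ hx0.ne', mul_one] at this
  rw [hc₁, div_le_iff₀ (by positivity)]
  refine h8.trans ?_
  have h9 : x * (Real.Gamma (1 - ρ) * x + (1 / 2) ^ (-ρ)) ≤
      (1 + x) ^ 2 * (Real.Gamma (1 - ρ) + (1 / 2) ^ (-ρ)) := by
    nlinarith [mul_pos hx0 hG, mul_pos hx0 hp, mul_pos (mul_pos hx0 hx0) hp]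
  calc _ = x * (Real.Gamma (1 - ρ) * x + (1 / 2) ^ (-ρ)) * mittagLeffler ρ (-x) := by ring
    _ ≤ (1 + x) ^ 2 * (Real.Gamma (1 - ρ) + (1 / 2) ^ (-ρ)) * mittagLeffler ρ (-x) := by gcongr
    _ = _ := by ring

/-! ### Uniqueness for the scalar equation -/

/-- A solution of `∂_t^ρ Z + m Z = 0` that is continuous up to `0` and vanishes there is nonnegative:
at a negative minimum the extremum principle would make the derivative negative. -/
lemma nonneg_of_hasDerivAt_volterra {ρ : ℝ} (hρ0 : 0 < ρ) (hρ1 : ρ < 1) {Z : ℝ → ℝ} {m b : ℝ}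
    (hm : 0 ≤ m) (hb : 0 ≤ b) (hZ : ContinuousOn Z (Icc 0 b)) (hZ0 : Z 0 = 0)
    (hdiff : ∀ t ∈ Ioc 0 b, DifferentiableAt ℝ Z t)
    (hD : ∀ t ∈ Ioc 0 b, HasDerivAt (volterra (fun x => x ^ (-ρ)) Z) (-m * Z t) t) :
    ∀ t ∈ Icc 0 b, 0 ≤ Z t := by
  obtain ⟨t₀, ht₀, hmin⟩ := isCompact_Icc.exists_isMinOn (nonempty_Icc.2 hb) hZ
  suffices h : 0 ≤ Z t₀ from fun t ht => h.trans (hmin ht)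
  by_contra! hneg
  have h0 : 0 < t₀ := by
    refine lt_of_le_of_ne ht₀.1 fun h => ?_
    rw [← h, hZ0] at hneg
    exact lt_irrefl _ hneg
  have hc : ∀ t ∈ Ioc 0 t₀, ContinuousOn Z (uIcc 0 t) := fun t ht => by
    rw [uIcc_of_le ht.1.le]
    exact hZ.mono (Icc_subset_Icc le_rfl (ht.2.trans ht₀.2))
  have h := deriv_volterra_rpow_neg_le hρ0 hρ1 (a := 0) le_rfl h0
    (fun t ht => (intervalIntegrable_sub_rpow (by linarith)).mul_continuousOn (hc t ht))
    (hc t₀ ⟨h0, le_rfl⟩).intervalIntegrable (by simp)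
    (fun s hs => hmin ⟨hs.1.le, hs.2.le.trans ht₀.2⟩) (hdiff t₀ ⟨h0, ht₀.2⟩) (hD t₀ ⟨h0, ht₀.2⟩)
  rw [intervalIntegral.integral_same, mul_zero, sub_zero, sub_zero] at h
  have h1 : 0 < t₀ ^ (-ρ) := Real.rpow_pos_of_pos h0 _
  nlinarith

lemma eq_zero_of_hasDerivAt_volterra {ρ : ℝ} (hρ0 : 0 < ρ) (hρ1 : ρ < 1) {Z : ℝ → ℝ} {m b : ℝ}
    (hm : 0 ≤ m) (hb : 0 ≤ b) (hZ : ContinuousOn Z (Icc 0 b)) (hZ0 : Z 0 = 0)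
    (hdiff : ∀ t ∈ Ioc 0 b, DifferentiableAt ℝ Z t)
    (hD : ∀ t ∈ Ioc 0 b, HasDerivAt (volterra (fun x => x ^ (-ρ)) Z) (-m * Z t) t) :
    ∀ t ∈ Icc 0 b, Z t = 0 := by
  intro t ht
  refine le_antisymm ?_ (nonneg_of_hasDerivAt_volterra hρ0 hρ1 hm hb hZ hZ0 hdiff hD t ht)
  have hneg : volterra (fun x => x ^ (-ρ)) (-Z) = -volterra (fun x => x ^ (-ρ)) Z := by
    ext t
    simp [volterra]
  have := nonneg_of_hasDerivAt_volterra hρ0 hρ1 (Z := -Z) hm hb hZ.neg (by simp [hZ0])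
    (fun t ht => (hdiff t ht).neg) (fun t ht => by
      rw [hneg]
      exact (hD t ht).neg.congr_deriv (by simp)) t ht
  simpa using this

lemma volterra_one {E : Type*} [NormedAddCommGroup E] [NormedSpace ℝ E] (f : ℝ → E) (t : ℝ) :
    volterra (fun _ => (1 : ℝ)) f t = ∫ s in (0 : ℝ)..t, f s := by
  simp [volterra]

/-- An integrable `z` with `∂_t^(ρ-1) z = -m ∫ z` vanishes: its primitive solves the homogeneous
equation of order `ρ` and is continuous up to `0`. -/
lemma eq_zero_of_volterra_eq_integral {ρ : ℝ} (hρ0 : 0 < ρ) (hρ1 : ρ < 1) {z : ℝ → ℝ} {m T : ℝ}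
    (hm : 0 ≤ m) (hz : ContinuousOn z (Ioo 0 T))
    (hzi : ∀ t ∈ Ioo 0 T, IntervalIntegrable z volume 0 t)
    (hV : ∀ t ∈ Ioo 0 T, volterra (fun x => x ^ (-ρ)) z t = -m * ∫ s in (0 : ℝ)..t, z s) :
    ∀ t ∈ Ioo 0 T, z t = 0 := by
  set Z := volterra (fun _ => (1 : ℝ)) z with hZdef
  have hZ' : ∀ t ∈ Ioo 0 T, HasDerivAt Z (z t) t := by
    intro t ht
    have hZfun : Z = fun t => ∫ s in (0 : ℝ)..t, z s := funext (volterra_one z)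
    rw [hZfun]
    refine intervalIntegral.integral_hasDerivAt_right (hzi t ht) ?_ (hz.continuousAt (isOpen_Ioo.mem_nhds ht))
    exact hz.stronglyMeasurableAtFilter isOpen_Ioo t ht
  have hZc : ∀ b ∈ Ioo 0 T, ContinuousOn Z (Icc 0 b) := by
    intro b hb
    have := intervalIntegral.continuousOn_primitive_interval' (hzi b hb)
      (left_mem_uIcc : (0 : ℝ) ∈ uIcc 0 b)
    rw [uIcc_of_le hb.1.le] at this
    exact this.congr fun t _ => volterra_one z t
  have hL {τ : ℝ} : volterra (fun x => x ^ (-ρ)) (fun _ => (1 : ℝ)) τ = τ ^ (1 - ρ) / (1 - ρ) := by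
    simp only [volterra, smul_eq_mul, mul_one]
    rw [integral_sub_rpow (by linarith), sub_zero, show -ρ + 1 = 1 - ρ by ring]
  have hR {τ : ℝ} : volterra (fun _ => (1 : ℝ)) (fun x => x ^ (-ρ)) τ = τ ^ (1 - ρ) / (1 - ρ) := by
    rw [volterra_one, integral_rpow (Or.inl (by linarith)), show -ρ + 1 = 1 - ρ by ring,
      Real.zero_rpow (by linarith), sub_zero]
  have hbound {t τ : ℝ} (hτ : τ ∈ Ioc 0 t) : τ ^ (1 - ρ) / (1 - ρ) ≤ t ^ (1 - ρ) / (1 - ρ) :=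
    div_le_div_of_nonneg_right (Real.rpow_le_rpow hτ.1.le hτ.2 (by linarith)) (by linarith)
  have hκm : Measurable fun x : ℝ => x ^ (-ρ) := measurable_id.pow_const _
  have hκ0 : ∀ x : ℝ, 0 ≤ x → 0 ≤ x ^ (-ρ) := fun x hx => Real.rpow_nonneg hx _
  have hVZ : ∀ t ∈ Ioo 0 T, volterra (fun x => x ^ (-ρ)) Z t = -m * ∫ s in (0 : ℝ)..t, Z s := by
    intro t ht
    have h1 := (volterra_assoc (M := t ^ (1 - ρ) / (1 - ρ)) ht.1.le hκm
      (measurable_const (a := (1 : ℝ))) hκ0 (fun _ _ => zero_le_one)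
      (fun τ _ => by simpa using intervalIntegrable_sub_rpow (t := τ) (by linarith))
      (fun τ hτ => by rw [hL]; exact hbound hτ) (hzi t ht)).2
    have h2 := (volterra_assoc (M := t ^ (1 - ρ) / (1 - ρ)) ht.1.le
      (measurable_const (a := (1 : ℝ))) hκm (fun _ _ => zero_le_one) hκ0
      (fun τ _ => by simpa using intervalIntegral.intervalIntegrable_rpow' (by linarith))
      (fun τ hτ => by rw [hR]; exact hbound hτ) (hzi t ht)).2
    have h3 : volterra (fun x => x ^ (-ρ)) (fun _ => (1 : ℝ)) =
        volterra (fun _ => (1 : ℝ)) (fun x => x ^ (-ρ)) := by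
      ext τ; rw [hL, hR]
    rw [hZdef, h1, h3, ← h2, volterra_one, ← intervalIntegral.integral_const_mul]
    refine intervalIntegral.integral_congr fun s hs => ?_
    rw [uIcc_of_le ht.1.le] at hs
    rcases eq_or_lt_of_le hs.1 with h | h
    · simp [← h, volterra]
    · simp only [volterra_one]
      exact hV s ⟨h, hs.2.trans_lt ht.2⟩
  have hZD : ∀ t ∈ Ioo 0 T, HasDerivAt (volterra (fun x => x ^ (-ρ)) Z) (-m * Z t) t := by
    intro t ht
    have hco : ContinuousOn Z (Ioo 0 T) := fun s hs => (hZ' s hs).continuousAt.continuousWithinAt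
    have := intervalIntegral.integral_hasDerivAt_right (a := 0) (f := Z) (b := t)
      ((hZc t ht).intervalIntegrable_of_Icc ht.1.le)
      (hco.stronglyMeasurableAtFilter isOpen_Ioo t ht) (hZ' t ht).continuousAt
    refine (this.const_mul (-m)).congr_of_eventuallyEq ?_
    filter_upwards [isOpen_Ioo.mem_nhds ht] with s hs using hVZ s hs
  have hZ0 : ∀ t ∈ Ioo 0 T, Z t = 0 := by
    intro t ht
    exact eq_zero_of_hasDerivAt_volterra hρ0 hρ1 hm ht.1.le (hZc t ht) (by simp [hZdef, volterra])
      (fun s hs => (hZ' s ⟨hs.1, hs.2.trans_lt ht.2⟩).differentiableAt)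
      (fun s hs => hZD s ⟨hs.1, hs.2.trans_lt ht.2⟩) t ⟨ht.1.le, le_rfl⟩
  intro t ht
  have h1 : HasDerivAt Z 0 t := by
    refine (hasDerivAt_const t (0 : ℝ)).congr_of_eventuallyEq ?_
    filter_upwards [isOpen_Ioo.mem_nhds ht] with s hs using hZ0 s hs
  exact (hZ' t ht).unique h1

/-- Uniqueness for the scalar backward problem: a solution of the homogeneous equation is a multiple
of the positive function `mlKernel ρ lam`. -/
lemma eq_zero_of_backward {ρ : ℝ} (hρ0 : 0 < ρ) (hρ1 : ρ < 1) {y : ℝ → ℝ} {lam T : ℝ}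
    (hlam : 0 ≤ lam) (hT : 0 < T) (hy : ContinuousOn y (Ioc 0 T))
    (hint : ∀ t ∈ Ioo 0 T, IntervalIntegrable (fun s => (t - s) ^ (-ρ) * y s) volume 0 t)
    (hD : ∀ t ∈ Ioo 0 T, HasDerivAt (volterra (fun x => x ^ (-ρ)) y)
      (-(Real.Gamma (1 - ρ) * lam) * y t) t)
    (hyT : y T = 0) : ∀ t ∈ Ioc 0 T, y t = 0 := by
  have hG : 0 < Real.Gamma (1 - ρ) := Real.Gamma_pos_of_pos (by linarith)
  have hyo : ContinuousOn y (Ioo 0 T) := hy.mono Ioo_subset_Ioc_self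
  have hyi : ∀ t ∈ Ioo 0 T, IntervalIntegrable y volume 0 t := by
    intro t ht
    obtain ⟨t', ht', ht'T⟩ := exists_between ht.2
    have h1 := (hint t' ⟨ht.1.trans ht', ht'T⟩).mono_set (c := 0) (d := t) (by
      rw [uIcc_of_le ht.1.le, uIcc_of_le (ht.1.trans ht').le]
      exact Icc_subset_Icc le_rfl ht'.le)
    have h2 : ContinuousOn (fun s => (t' - s) ^ ρ) (uIcc 0 t) :=
      ((continuous_const.sub continuous_id).rpow_const fun _ => Or.inr hρ0.le).continuousOn
    refine (h1.continuousOn_mul h2).congr fun s hs => ?_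
    rw [uIoc_of_le ht.1.le] at hs
    have : 0 < t' - s := by linarith [hs.2]
    rw [← mul_assoc, ← Real.rpow_add this, add_neg_cancel, Real.rpow_zero, one_mul]
  set V := volterra (fun x => x ^ (-ρ)) y with hVdef
  have hconst : ∃ c₀, ∀ t ∈ Ioo 0 T, V t + Real.Gamma (1 - ρ) * lam * ∫ s in (0 : ℝ)..t, y s = c₀ := by
    have hd : ∀ t ∈ Ioo 0 T, HasDerivAt
        (fun t => V t + Real.Gamma (1 - ρ) * lam * ∫ s in (0 : ℝ)..t, y s) 0 t := by
      intro t ht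
      have h1 := intervalIntegral.integral_hasDerivAt_right (hyi t ht)
        (hyo.stronglyMeasurableAtFilter isOpen_Ioo t ht)
        (hyo.continuousAt (isOpen_Ioo.mem_nhds ht))
      exact ((hD t ht).add (h1.const_mul (Real.Gamma (1 - ρ) * lam))).congr_deriv (by ring)
    obtain ⟨c₀, hc₀⟩ := isOpen_Ioo.exists_is_const_of_deriv_eq_zero isPreconnected_Ioo
      (fun t ht => (hd t ht).differentiableAt.differentiableWithinAt)
      (fun t ht => (hd t ht).deriv)
    exact ⟨c₀, hc₀⟩
  obtain ⟨c₀, hc₀⟩ := hconst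
  set c := c₀ / Real.Gamma (1 - ρ) with hc
  have hei (t : ℝ) := intervalIntegrable_mlKernel hρ0 hρ1 lam t
  have hec : ContinuousOn (mlKernel ρ lam) (Ioi 0) := fun t ht =>
    (continuousAt_mlKernel hρ0 hρ1 lam ht).continuousWithinAt
  have hz := eq_zero_of_volterra_eq_integral hρ0 hρ1 (z := fun t => y t - c * mlKernel ρ lam t)
    (m := Real.Gamma (1 - ρ) * lam) (T := T) (by positivity)
    (hyo.sub (continuousOn_const.mul (hec.mono Ioo_subset_Ioi_self)))
    (fun t ht => (hyi t ht).sub ((hei t).const_mul c)) (fun t ht => by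
      have e1 : volterra (fun x => x ^ (-ρ)) (fun t => y t - c * mlKernel ρ lam t) t =
          V t - c * volterra (fun x => x ^ (-ρ)) (mlKernel ρ lam) t := by
        have h2 := intervalIntegrable_rpow_neg_mul_mlKernel hρ0 hρ1 lam ht.1
        rw [hVdef]
        simp only [volterra, smul_eq_mul]
        rw [← intervalIntegral.integral_const_mul, ← intervalIntegral.integral_sub (hint t ht)
          (h2.const_mul c)]
        congr 1
        ext s
        ring
      rw [e1, volterra_rpow_neg_mlKernel hρ0 hρ1 lam ht.1,
        intervalIntegral.integral_sub (hyi t ht) ((hei t).const_mul c),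
        intervalIntegral.integral_const_mul]
      have h3 := hc₀ t ht
      have h4 : c * Real.Gamma (1 - ρ) = c₀ := div_mul_cancel₀ _ hG.ne'
      linear_combination h3 - h4)
  have hyeq : ∀ t ∈ Ioo 0 T, y t = c * mlKernel ρ lam t := fun t ht => sub_eq_zero.1 (hz t ht)
  have hlim : Tendsto (fun t => y t - c * mlKernel ρ lam t) (𝓝[<] T)
      (𝓝 (y T - c * mlKernel ρ lam T)) := by
    have h1 : Tendsto y (𝓝[Ioo 0 T] T) (𝓝 (y T)) :=
      (hy T ⟨hT, le_rfl⟩).mono_left (nhdsWithin_mono _ Ioo_subset_Ioc_self)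
    rw [nhdsWithin_Ioo_eq_nhdsLT hT] at h1
    exact h1.sub (((continuousAt_mlKernel hρ0 hρ1 lam hT).tendsto.mono_left
      nhdsWithin_le_nhds).const_mul c)
  have hlim0 : Tendsto (fun t => y t - c * mlKernel ρ lam t) (𝓝[<] T) (𝓝 0) := by
    refine tendsto_const_nhds.congr' ?_
    filter_upwards [Ioo_mem_nhdsLT hT] with t ht using (hz t ht).symm
  have hcT := tendsto_nhds_unique hlim hlim0
  have hepos := mlKernel_pos hρ0 hρ1 hlam hT
  have hc0 : c = 0 := by
    rw [hyT, zero_sub, neg_eq_zero] at hcT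
    exact (mul_eq_zero.1 hcT).resolve_right hepos.ne'
  intro t ht
  rcases eq_or_lt_of_le ht.2 with h | h
  · rw [h, hyT]
  · rw [hyeq t ⟨ht.1, h⟩, hc0, zero_mul]

/-! ### Diagonal operators and powers in an orthonormal basis -/

section Diagonal

variable {𝕜 H : Type*} [RCLike 𝕜] [NormedAddCommGroup H] [InnerProductSpace 𝕜 H]

lemma hasSum_sq_norm_inner (v : HilbertBasis ℕ 𝕜 H) (x : H) :
    HasSum (fun k => ‖inner 𝕜 (v k) x‖ ^ 2) (‖x‖ ^ 2) := by
  have h := (v.hasSum_inner_mul_inner x x).mapL (RCLike.reCLM : 𝕜 →L[ℝ] ℝ)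
  have e : ∀ k, (RCLike.reCLM : 𝕜 →L[ℝ] ℝ) (inner 𝕜 x (v k) * inner 𝕜 (v k) x) =
      ‖inner 𝕜 (v k) x‖ ^ 2 := by
    intro k
    rw [← inner_conj_symm, RCLike.conj_mul]
    rw [← RCLike.ofReal_pow]
    exact RCLike.ofReal_re _
  have e' : (RCLike.reCLM : 𝕜 →L[ℝ] ℝ) (inner 𝕜 x x) = ‖x‖ ^ 2 := inner_self_eq_norm_sq x
  rw [e'] at h
  simpa only [e] using h

lemma ext_inner_hilbertBasis (v : HilbertBasis ℕ 𝕜 H) {x y : H}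
    (h : ∀ k, inner 𝕜 (v k) x = inner 𝕜 (v k) y) : x = y := by
  rw [← sub_eq_zero, ← norm_eq_zero, ← sq_eq_zero_iff]
  refine (hasSum_sq_norm_inner v (x - y)).unique ?_
  simp only [inner_sub_right, h, sub_self, norm_zero, ne_eq, OfNat.ofNat_ne_zero,
    not_false_eq_true, zero_pow]
  exact hasSum_zero

/-- The vector with coordinates `a k` in the orthonormal basis `v`; meaningful if `a` is square
summable. -/
noncomputable def ofCoords (v : HilbertBasis ℕ 𝕜 H) (a : ℕ → 𝕜) : H := ∑' k, a k • v k

lemma inner_ofCoords (v : HilbertBasis ℕ 𝕜 H) {a : ℕ → 𝕜} (ha : Summable fun k => ‖a k‖ ^ 2)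
    (k : ℕ) : inner 𝕜 (v k) (ofCoords v a) = a k := by
  have hmem : Memℓp a 2 := by
    rw [memℓp_gen_iff (by norm_num)]
    simpa using ha
  have h := v.hasSum_repr_symm ⟨a, hmem⟩
  rw [ofCoords, h.tsum_eq, ← v.repr_apply_apply, LinearIsometryEquiv.apply_symm_apply]

/-- The diagonal operator with multipliers `m k` in the orthonormal basis `v`; meaningful if `m` is
bounded. -/
noncomputable def diagOp (v : HilbertBasis ℕ 𝕜 H) (m : ℕ → ℝ) (x : H) : H :=
  ofCoords v fun k => (m k : 𝕜) * inner 𝕜 (v k) x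

lemma norm_sq_ofReal_mul_inner_le (v : HilbertBasis ℕ 𝕜 H) {m : ℕ → ℝ} {M : ℝ}
    (hm : ∀ k, |m k| ≤ M) (x : H) (k : ℕ) :
    ‖(m k : 𝕜) * inner 𝕜 (v k) x‖ ^ 2 ≤ M ^ 2 * ‖inner 𝕜 (v k) x‖ ^ 2 := by
  rw [norm_mul, RCLike.norm_ofReal, mul_pow]
  gcongr
  exact hm k

lemma inner_diagOp (v : HilbertBasis ℕ 𝕜 H) {m : ℕ → ℝ} {M : ℝ} (hm : ∀ k, |m k| ≤ M) (x : H)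
    (k : ℕ) : inner 𝕜 (v k) (diagOp v m x) = (m k : 𝕜) * inner 𝕜 (v k) x :=
  inner_ofCoords v (Summable.of_nonneg_of_le (fun _ => by positivity)
    (norm_sq_ofReal_mul_inner_le v hm x) ((hasSum_sq_norm_inner v x).summable.mul_left _)) k

lemma norm_diagOp_le (v : HilbertBasis ℕ 𝕜 H) {m : ℕ → ℝ} {M : ℝ} (hm : ∀ k, |m k| ≤ M) (x : H) :
    ‖diagOp v m x‖ ≤ M * ‖x‖ := by
  have hM : 0 ≤ M := (abs_nonneg _).trans (hm 0)
  refine le_of_sq_le_sq ?_ (by positivity)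
  rw [mul_pow]
  refine hasSum_le (fun k => ?_) (hasSum_sq_norm_inner v (diagOp v m x))
    ((hasSum_sq_norm_inner v x).mul_left (M ^ 2))
  rw [inner_diagOp v hm]
  exact norm_sq_ofReal_mul_inner_le v hm x k

lemma diagOp_sub (v : HilbertBasis ℕ 𝕜 H) {m : ℕ → ℝ} {M : ℝ} (hm : ∀ k, |m k| ≤ M) (x y : H) :
    diagOp v m (x - y) = diagOp v m x - diagOp v m y := by
  refine ext_inner_hilbertBasis v fun k => ?_
  simp only [inner_sub_right, inner_diagOp v hm, mul_sub]

/-- Uniformly bounded diagonal operators with pointwise convergent multipliers converge strongly,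
jointly with the argument. -/
lemma tendsto_diagOp (v : HilbertBasis ℕ 𝕜 H) {ι : Type*} {l : Filter ι} {m : ι → ℕ → ℝ} {m₀ : ℕ → ℝ}
    {M : ℝ} (hb : ∀ᶠ i in l, ∀ k, |m i k| ≤ M) (hb₀ : ∀ k, |m₀ k| ≤ M)
    (hm : ∀ k, Tendsto (fun i => m i k) l (𝓝 (m₀ k))) {x : ι → H} {x₀ : H}
    (hx : Tendsto x l (𝓝 x₀)) : Tendsto (fun i => diagOp v (m i) (x i)) l (𝓝 (diagOp v m₀ x₀)) := by
  have hM : 0 ≤ M := (abs_nonneg _).trans (hb₀ 0)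
  have h1 : Tendsto (fun i => ‖diagOp v (m i) x₀ - diagOp v m₀ x₀‖ ^ 2) l (𝓝 0) := by
    have ht : Tendsto (fun i => ∑' k, |m i k - m₀ k| ^ 2 * ‖inner 𝕜 (v k) x₀‖ ^ 2) l
        (𝓝 (∑' _ : ℕ, (0 : ℝ))) := by
      refine tendsto_tsum_of_dominated_convergence
        (bound := fun k => (2 * M) ^ 2 * ‖inner 𝕜 (v k) x₀‖ ^ 2)
        ((hasSum_sq_norm_inner v x₀).summable.mul_left _) (fun k => ?_) ?_
      · have := (((hm k).sub_const (m₀ k)).abs.pow 2).mul_const (‖inner 𝕜 (v k) x₀‖ ^ 2)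
        simpa using this
      · filter_upwards [hb] with i hi k
        rw [Real.norm_of_nonneg (by positivity)]
        gcongr
        exact (abs_sub _ _).trans (by linarith [hi k, hb₀ k])
    rw [tsum_zero] at ht
    refine ht.congr' ?_
    filter_upwards [hb] with i hi
    rw [← (hasSum_sq_norm_inner v (diagOp v (m i) x₀ - diagOp v m₀ x₀)).tsum_eq]
    refine tsum_congr fun k => ?_
    rw [inner_sub_right, inner_diagOp v hi, inner_diagOp v hb₀, ← sub_mul, ← RCLike.ofReal_sub,
      norm_mul, RCLike.norm_ofReal, mul_pow]
  have h2 : Tendsto (fun i => ‖diagOp v (m i) x₀ - diagOp v m₀ x₀‖) l (𝓝 0) := by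
    simpa using h1.sqrt
  rw [tendsto_iff_norm_sub_tendsto_zero]
  have h3 : Tendsto (fun i => M * ‖x i - x₀‖ + ‖diagOp v (m i) x₀ - diagOp v m₀ x₀‖) l (𝓝 0) := by
    simpa using ((tendsto_iff_norm_sub_tendsto_zero.1 hx).const_mul M).add h2
  refine squeeze_zero' (Eventually.of_forall fun _ => norm_nonneg _) ?_ h3
  filter_upwards [hb] with i hi
  calc ‖diagOp v (m i) (x i) - diagOp v m₀ x₀‖
      = ‖diagOp v (m i) (x i - x₀) + (diagOp v (m i) x₀ - diagOp v m₀ x₀)‖ := by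
        rw [diagOp_sub v hi]; congr 1; abel
    _ ≤ _ := (norm_add_le _ _).trans (by gcongr; exact norm_diagOp_le v hi _)

lemma inner_of_mem_graph [CompleteSpace H] {A : H →ₗ.[𝕜] H} (hA : IsSelfAdjoint A)
    {v : HilbertBasis ℕ 𝕜 H} {lam : ℕ → ℝ} (hv : ∀ k, (v k, (lam k : 𝕜) • v k) ∈ A.graph)
    {x w : H} (h : (x, w) ∈ A.graph) (k : ℕ) :
    inner 𝕜 (v k) w = (lam k : 𝕜) * inner 𝕜 (v k) x := by
  have hF : A.IsFormalAdjoint A := by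
    have := LinearPMap.adjoint_isFormalAdjoint (T := A) hA.dense_domain
    rwa [LinearPMap.isSelfAdjoint_def.1 hA] at this
  obtain ⟨y, hy, hyw⟩ := (LinearPMap.mem_graph_iff A).1 h
  obtain ⟨z, hz, hzw⟩ := (LinearPMap.mem_graph_iff A).1 (hv k)
  have h1 := hF z y
  simp only at hy hyw hz hzw
  rw [hzw, hyw, hz, hy, inner_smul_left, RCLike.conj_ofReal] at h1
  exact h1.symm

lemma mem_graph_of_inner [CompleteSpace H] {A : H →ₗ.[𝕜] H} (hA : IsSelfAdjoint A)
    {v : HilbertBasis ℕ 𝕜 H} {lam : ℕ → ℝ} (hv : ∀ k, (v k, (lam k : 𝕜) • v k) ∈ A.graph)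
    {x w : H} (h : ∀ k, inner 𝕜 (v k) w = (lam k : 𝕜) * inner 𝕜 (v k) x) :
    (x, w) ∈ A.graph := by
  have h1 := v.hasSum_repr x
  have h2 := v.hasSum_repr w
  have hc : IsClosed (A.graph : Set (H × H)) := hA.isClosed
  refine hc.mem_of_tendsto (h1.prodMk h2) (Eventually.of_forall fun s => ?_)
  refine A.graph.sum_mem fun k _ => ?_
  have := A.graph.smul_mem (inner 𝕜 (v k) x) (hv k)
  simp only [v.repr_apply_apply, h]
  convert this using 1
  rw [Prod.smul_mk, smul_smul, mul_comm]

/-- `G` is the vector `A ^ τ g`, in coordinates. -/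
def IsPow (v : HilbertBasis ℕ 𝕜 H) (lam : ℕ → ℝ) (τ : ℝ) (g G : H) : Prop :=
  ∀ k, inner 𝕜 (v k) G = ((lam k ^ τ : ℝ) : 𝕜) * inner 𝕜 (v k) g

lemma norm_sq_rpow_mul_inner (v : HilbertBasis ℕ 𝕜 H) {lam : ℕ → ℝ} (hlam : ∀ k, 0 < lam k) (τ : ℝ)
    (g : H) (k : ℕ) : ‖((lam k ^ τ : ℝ) : 𝕜) * inner 𝕜 (v k) g‖ ^ 2 =
      lam k ^ (2 * τ) * ‖inner 𝕜 (v k) g‖ ^ 2 := by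
  rw [norm_mul, RCLike.norm_ofReal, abs_of_pos (Real.rpow_pos_of_pos (hlam k) _), mul_pow,
    mul_comm 2 τ, Real.rpow_mul (hlam k).le, Real.rpow_two]

lemma MemPowDomain.exists_isPow {v : HilbertBasis ℕ 𝕜 H} {lam : ℕ → ℝ} (hlam : ∀ k, 0 < lam k)
    {τ : ℝ} {g : H} (hg : MemPowDomain v lam τ g) : ∃ G, IsPow v lam τ g G :=
  ⟨_, inner_ofCoords v (hg.congr fun k => (norm_sq_rpow_mul_inner v hlam τ g k).symm)⟩

lemma IsPow.powNorm_eq {v : HilbertBasis ℕ 𝕜 H} {lam : ℕ → ℝ} (hlam : ∀ k, 0 < lam k) {τ : ℝ}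
    {g G : H} (h : IsPow v lam τ g G) : powNorm v lam τ g = ‖G‖ := by
  have h1 := (hasSum_sq_norm_inner v G).tsum_eq
  simp only [h _, norm_sq_rpow_mul_inner v hlam] at h1
  rw [powNorm, h1, Real.sqrt_sq (norm_nonneg _)]

/-- `F ∈ C([0, T]; D(A ^ τ))` means that `A ^ τ F` is a continuous function on `[0, T]`. -/
lemma ContInPowDomain.exists_isPow {v : HilbertBasis ℕ 𝕜 H} {lam : ℕ → ℝ} (hlam : ∀ k, 0 < lam k)
    {τ T : ℝ} {F : ℝ → H} (hF : ContInPowDomain v lam τ T F) :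
    ∃ G : ℝ → H, ContinuousOn G (Icc 0 T) ∧ (∀ t ∈ Icc 0 T, IsPow v lam τ (F t) (G t)) ∧
      ∀ t ∈ Icc 0 T, ‖G t‖ ≤ maxPowNorm v lam τ T F := by
  have hex : ∀ t, ∃ G, t ∈ Icc 0 T → IsPow v lam τ (F t) G := by
    intro t
    by_cases ht : t ∈ Icc 0 T
    · obtain ⟨G, hG⟩ := (hF.1 t ht).exists_isPow hlam
      exact ⟨G, fun _ => hG⟩
    · exact ⟨0, fun h => absurd h ht⟩
  choose G hG using hex
  have hcont : ContinuousOn G (Icc 0 T) := by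
    intro s hs
    rw [ContinuousWithinAt, tendsto_iff_norm_sub_tendsto_zero]
    refine (hF.2 s hs).congr' ?_
    filter_upwards [self_mem_nhdsWithin] with t ht
    refine IsPow.powNorm_eq hlam fun k => ?_
    rw [inner_sub_right, inner_sub_right, hG t ht k, hG s hs k, mul_sub]
  refine ⟨G, hcont, hG, fun t ht => ?_⟩
  rw [← (hG t ht).powNorm_eq hlam]
  refine le_csSup ?_ (mem_image_of_mem _ ht)
  obtain ⟨C, hC⟩ := isCompact_Icc.exists_bound_of_continuousOn hcont
  refine ⟨C, ?_⟩
  rintro _ ⟨s, hs, rfl⟩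
  simpa only [(hG s hs).powNorm_eq hlam] using hC s hs

end Diagonal

/-! ### Weighted integrals and variation of constants -/

section Weighted

variable {E : Type*} [NormedAddCommGroup E] [NormedSpace ℝ E]

lemma intervalIntegrable_weight_smul {w : ℝ → ℝ} (hw : IntervalIntegrable w volume 0 1) {Q : ℝ → E}
    {C : ℝ} (hQ : ContinuousOn Q (Ioo 0 1)) (hC : ∀ θ ∈ Ioo (0 : ℝ) 1, ‖Q θ‖ ≤ C) :
    IntervalIntegrable (fun θ => w θ • Q θ) volume 0 1 := by
  rw [intervalIntegrable_iff_integrableOn_Ioo_of_le zero_le_one] at hw ⊢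
  refine Integrable.mono' (hw.norm.mul_const C)
    (hw.aestronglyMeasurable.smul (hQ.aestronglyMeasurable measurableSet_Ioo)) ?_
  filter_upwards [ae_restrict_mem measurableSet_Ioo] with θ hθ
  rw [norm_smul]
  exact mul_le_mul_of_nonneg_left (hC θ hθ) (norm_nonneg _)

lemma norm_integral_weight_smul_le {w : ℝ → ℝ} (hw : IntervalIntegrable w volume 0 1)
    (hw0 : ∀ θ ∈ Ioo (0 : ℝ) 1, 0 ≤ w θ) {Q : ℝ → E} {C : ℝ}
    (hC : ∀ θ ∈ Ioo (0 : ℝ) 1, ‖Q θ‖ ≤ C) :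
    ‖∫ θ in (0 : ℝ)..1, w θ • Q θ‖ ≤ (∫ θ in (0 : ℝ)..1, w θ) * C := by
  rw [← intervalIntegral.integral_mul_const]
  rw [intervalIntegral.integral_of_le zero_le_one, intervalIntegral.integral_of_le zero_le_one,
    integral_Ioc_eq_integral_Ioo, integral_Ioc_eq_integral_Ioo]
  rw [intervalIntegrable_iff_integrableOn_Ioo_of_le zero_le_one] at hw
  refine norm_integral_le_of_norm_le (hw.mul_const C) ?_
  filter_upwards [ae_restrict_mem measurableSet_Ioo] with θ hθ
  rw [norm_smul, Real.norm_of_nonneg (hw0 θ hθ)]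
  exact mul_le_mul_of_nonneg_left (hC θ hθ) (hw0 θ hθ)

lemma continuousOn_integral_weight_smul {w : ℝ → ℝ} (hw : IntervalIntegrable w volume 0 1)
    {Q : ℝ → ℝ → E} {S : Set ℝ} {C : ℝ} (hQ : ∀ t ∈ S, ContinuousOn (Q t) (Ioo 0 1))
    (hQt : ∀ θ ∈ Ioo (0 : ℝ) 1, ContinuousOn (fun t => Q t θ) S)
    (hC : ∀ t ∈ S, ∀ θ ∈ Ioo (0 : ℝ) 1, ‖Q t θ‖ ≤ C) :
    ContinuousOn (fun t => ∫ θ in (0 : ℝ)..1, w θ • Q t θ) S := by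
  have hae : ∀ᵐ θ : ℝ, θ ∈ uIoc (0 : ℝ) 1 → θ ∈ Ioo (0 : ℝ) 1 := by
    filter_upwards [Measure.ae_ne volume (1 : ℝ)] with θ h1 hθ
    rw [uIoc_of_le zero_le_one] at hθ
    exact ⟨hθ.1, lt_of_le_of_ne hθ.2 h1⟩
  intro t ht
  refine intervalIntegral.continuousWithinAt_of_dominated_interval
    (bound := fun θ => ‖w θ‖ * C) ?_ ?_ (hw.norm.mul_const C) ?_
  · filter_upwards [self_mem_nhdsWithin] with s hs
    have := intervalIntegrable_weight_smul hw (hQ s hs) (hC s hs)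
    rw [uIoc_of_le zero_le_one]
    exact ((intervalIntegrable_iff_integrableOn_Ioc_of_le zero_le_one).1 this).aestronglyMeasurable
  · filter_upwards [self_mem_nhdsWithin] with s hs
    filter_upwards [hae] with θ h hθ
    rw [norm_smul]
    exact mul_le_mul_of_nonneg_left (hC s hs θ (h hθ)) (norm_nonneg _)
  · filter_upwards [hae] with θ h hθ
    exact (hQt θ (h hθ) t ht).const_smul (w θ)

end Weighted

lemma mlKernel_nonneg {ρ : ℝ} (hρ0 : 0 < ρ) (hρ1 : ρ < 1) {lam t : ℝ} (hlam : 0 ≤ lam)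
    (ht : 0 ≤ t) : 0 ≤ mlKernel ρ lam t := by
  rcases eq_or_lt_of_le ht with h | h
  · simp [← h, mlKernel, Real.zero_rpow (show ρ - 1 ≠ 0 by linarith)]
  · exact (mlKernel_pos hρ0 hρ1 hlam h).le

/-- Variation of constants: the function `U = e c + e * f`, with `e = mlKernel ρ lam`, satisfies the
integrated equation `∂_t^(ρ-1) U = c + ∫ (f - lam U)`. -/
lemma volterra_mild {E : Type*} [NormedAddCommGroup E] [NormedSpace ℝ E] [CompleteSpace E] {ρ : ℝ}
    (hρ0 : 0 < ρ) (hρ1 : ρ < 1) {lam t : ℝ} (hlam : 0 ≤ lam) (ht : 0 < t) (c : E) {f : ℝ → E}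
    (hf : IntervalIntegrable f volume 0 t) :
    IntervalIntegrable (fun s => mlKernel ρ lam s • c + volterra (mlKernel ρ lam) f s) volume 0 t ∧
    volterra (fun x => x ^ (-ρ)) (fun s => mlKernel ρ lam s • c + volterra (mlKernel ρ lam) f s) t =
      Real.Gamma (1 - ρ) • (c + (∫ s in (0 : ℝ)..t, f s) -
        lam • ∫ s in (0 : ℝ)..t, (mlKernel ρ lam s • c + volterra (mlKernel ρ lam) f s)) := by
  have hG : 0 < Real.Gamma (1 - ρ) := Real.Gamma_pos_of_pos (by linarith)
  set e := mlKernel ρ lam with he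
  have hei (τ : ℝ) : IntervalIntegrable e volume 0 τ := intervalIntegrable_mlKernel hρ0 hρ1 lam τ
  have he0 : ∀ x, 0 ≤ x → 0 ≤ e x := fun x hx => mlKernel_nonneg hρ0 hρ1 hlam hx
  have hem : Measurable e := measurable_mlKernel hρ0 hρ1 lam
  have hI0 {τ : ℝ} (hτ : 0 ≤ τ) : 0 ≤ ∫ s in (0 : ℝ)..τ, e s :=
    intervalIntegral.integral_nonneg hτ fun s hs => he0 s hs.1
  have hκe {τ : ℝ} (hτ : 0 < τ) : volterra (fun x => x ^ (-ρ)) e τ =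
      Real.Gamma (1 - ρ) * (1 - lam * ∫ s in (0 : ℝ)..τ, e s) :=
    volterra_rpow_neg_mlKernel hρ0 hρ1 lam hτ
  obtain ⟨i1, a1⟩ := volterra_assoc (a := fun x => x ^ (-ρ)) (b := e) (M := Real.Gamma (1 - ρ)) ht.le
    (measurable_id.pow_const _) hem (fun x hx => Real.rpow_nonneg hx _) he0
    (fun τ hτ => intervalIntegrable_rpow_neg_mul_mlKernel hρ0 hρ1 lam hτ.1)
    (fun τ hτ => by
      rw [hκe hτ.1]
      exact mul_le_of_le_one_right hG.le (by linarith [mul_nonneg hlam (hI0 hτ.1.le)])) hf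
  obtain ⟨i2, a2⟩ := volterra_assoc (a := fun _ => (1 : ℝ)) (b := e) (M := ∫ s in (0 : ℝ)..t, e s)
    ht.le measurable_const hem (fun _ _ => zero_le_one) he0
    (fun τ _ => by simpa using hei τ)
    (fun τ hτ => by
      rw [volterra_one]
      refine intervalIntegral.integral_mono_interval le_rfl hτ.1.le hτ.2 ?_ (hei t)
      filter_upwards [ae_restrict_mem measurableSet_Ioc] with s hs using he0 s hs.1.le) hf
  simp only [one_smul] at i2
  rw [volterra_one] at a2
  have hone : volterra (fun _ => (1 : ℝ)) e = fun τ => ∫ s in (0 : ℝ)..τ, e s := funext (volterra_one e)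
  have ie : IntervalIntegrable (fun s => e s • c) volume 0 t := (hei t).smul_continuousOn continuousOn_const
  refine ⟨ie.add i2, ?_⟩
  have e1 : volterra (fun x => x ^ (-ρ)) (fun s => e s • c + volterra e f s) t =
      volterra (fun x => x ^ (-ρ)) e t • c +
        volterra (fun x => x ^ (-ρ)) (volterra e f) t := by
    have j := (intervalIntegrable_rpow_neg_mul_mlKernel hρ0 hρ1 lam ht).smul_continuousOn
      (continuousOn_const (c := c))
    have e3 : (fun s => (t - s) ^ (-ρ) • (e s • c + volterra e f s)) =
        fun s => ((t - s) ^ (-ρ) * e s) • c + (t - s) ^ (-ρ) • volterra e f s := by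
      ext s; rw [smul_add, smul_smul]
    rw [volterra, e3, intervalIntegral.integral_add j i1, intervalIntegral.integral_smul_const]
    rfl
  have hIc : ContinuousOn (fun s => ∫ r in (0 : ℝ)..(t - s), e r) (uIcc 0 t) := by
    have h1 := intervalIntegral.continuousOn_primitive_interval' (hei t) (left_mem_uIcc : (0 : ℝ) ∈ uIcc 0 t)
    refine h1.comp (by fun_prop) fun s hs => ?_
    rw [uIcc_of_le ht.le] at hs ⊢
    exact ⟨by linarith [hs.2], by linarith [hs.1]⟩
  have e2 : volterra (volterra (fun x => x ^ (-ρ)) e) f t = Real.Gamma (1 - ρ) •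
      ((∫ s in (0 : ℝ)..t, f s) - lam • ∫ s in (0 : ℝ)..t, volterra e f s) := by
    have k1 : IntervalIntegrable (fun s => (∫ r in (0 : ℝ)..(t - s), e r) • f s) volume 0 t :=
      hf.continuousOn_smul hIc
    have k2 : IntervalIntegrable (fun s => lam • (∫ r in (0 : ℝ)..(t - s), e r) • f s) volume 0 t :=
      k1.smul lam
    rw [a2, hone, volterra, volterra, ← intervalIntegral.integral_smul,
      ← intervalIntegral.integral_sub hf k2, ← intervalIntegral.integral_smul]
    refine intervalIntegral.integral_congr_ae ?_
    filter_upwards [Measure.ae_ne volume t] with s hs hs'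
    rw [uIoc_of_le ht.le] at hs'
    have : 0 < t - s := sub_pos.2 (lt_of_le_of_ne hs'.2 hs)
    rw [hκe this, mul_smul, sub_smul, one_smul, mul_smul]
  rw [e1, a1, e2, hκe ht, intervalIntegral.integral_add ie i2, intervalIntegral.integral_smul_const]
  module

section Solution

variable {𝕜 H : Type*} [RCLike 𝕜] [NormedAddCommGroup H] [InnerProductSpace 𝕜 H]

lemma inner_real_smul [NormedSpace ℝ H] [IsScalarTower ℝ 𝕜 H] (x y : H) (r : ℝ) : inner 𝕜 x (r • y) = r • inner 𝕜 x y := by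
  rw [RCLike.real_smul_eq_coe_smul (K := 𝕜), inner_smul_right, RCLike.real_smul_eq_coe_mul]

lemma inner_intervalIntegral [NormedSpace ℝ H] [CompleteSpace H] (x : H) {f : ℝ → H} {a b : ℝ}
    (hf : IntervalIntegrable f volume a b) :
    inner 𝕜 x (∫ s in a..b, f s) = ∫ s in a..b, inner 𝕜 x (f s) :=
  ((innerSL 𝕜 x).intervalIntegral_comp_comm hf).symm

/-- The operator `E_{ρ,ρ}(-t ^ ρ A)`. -/
noncomputable def mlOp (v : HilbertBasis ℕ 𝕜 H) (lam : ℕ → ℝ) (ρ t : ℝ) (x : H) : H :=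
  diagOp v (fun k => mittagLeffler ρ (-(lam k * t ^ ρ))) x

lemma abs_mittagLeffler_neg_le {ρ : ℝ} (hρ0 : 0 < ρ) (hρ1 : ρ < 1) {lam : ℕ → ℝ}
    (hlam : ∀ k, 0 < lam k) {t : ℝ} (ht : 0 ≤ t) (k : ℕ) :
    |mittagLeffler ρ (-(lam k * t ^ ρ))| ≤ (Real.Gamma ρ)⁻¹ := by
  have h : 0 ≤ lam k * t ^ ρ := mul_nonneg (hlam k).le (Real.rpow_nonneg ht _)
  rw [abs_of_pos (mittagLeffler_neg_pos hρ0 hρ1 h)]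
  exact mittagLeffler_neg_le_inv_Gamma hρ0 hρ1 h

lemma norm_mlOp_le (v : HilbertBasis ℕ 𝕜 H) {ρ : ℝ} (hρ0 : 0 < ρ) (hρ1 : ρ < 1) {lam : ℕ → ℝ}
    (hlam : ∀ k, 0 < lam k) {t : ℝ} (ht : 0 ≤ t) (x : H) :
    ‖mlOp v lam ρ t x‖ ≤ (Real.Gamma ρ)⁻¹ * ‖x‖ :=
  norm_diagOp_le v (abs_mittagLeffler_neg_le hρ0 hρ1 hlam ht) x

lemma inner_mlOp (v : HilbertBasis ℕ 𝕜 H) {ρ : ℝ} (hρ0 : 0 < ρ) (hρ1 : ρ < 1) {lam : ℕ → ℝ}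
    (hlam : ∀ k, 0 < lam k) {t : ℝ} (ht : 0 ≤ t) (x : H) (k : ℕ) :
    inner 𝕜 (v k) (mlOp v lam ρ t x) =
      (mittagLeffler ρ (-(lam k * t ^ ρ)) : 𝕜) * inner 𝕜 (v k) x :=
  inner_diagOp v (abs_mittagLeffler_neg_le hρ0 hρ1 hlam ht) x k

lemma continuousOn_mlOp (v : HilbertBasis ℕ 𝕜 H) {ρ : ℝ} (hρ0 : 0 < ρ) (hρ1 : ρ < 1) {lam : ℕ → ℝ}
    (hlam : ∀ k, 0 < lam k) {S : Set ℝ} {a : ℝ → ℝ} {x : ℝ → H} (ha : ContinuousOn a S)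
    (ha0 : ∀ s ∈ S, 0 ≤ a s) (hx : ContinuousOn x S) :
    ContinuousOn (fun s => mlOp v lam ρ (a s) (x s)) S := by
  intro s hs
  refine tendsto_diagOp v (M := (Real.Gamma ρ)⁻¹) ?_ (abs_mittagLeffler_neg_le hρ0 hρ1 hlam (ha0 s hs))
    (fun k => ?_) (hx s hs)
  · filter_upwards [self_mem_nhdsWithin] with r hr
    exact abs_mittagLeffler_neg_le hρ0 hρ1 hlam (ha0 r hr)
  · exact ((continuous_mittagLeffler_rpow hρ0 hρ1 (lam k)).tendsto (a s)).comp (ha s hs)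

end Solution

/-! ### The mild solution -/

section Solution

variable {𝕜 H : Type*} [RCLike 𝕜] [NormedAddCommGroup H] [InnerProductSpace 𝕜 H] [NormedSpace ℝ H]

lemma intervalIntegrable_weight {a b : ℝ} (ha : 0 < a) (hb : 0 < b) :
    IntervalIntegrable (fun θ : ℝ => (1 - θ) ^ (a - 1) * θ ^ (b - 1)) volume 0 1 :=
  intervalIntegrable_rpow_mul_rpow ha hb one_pos

/-- The Duhamel integral `∫₀ᵗ (t - s) ^ (ρ - 1) E_{ρ,ρ}(-(t - s) ^ ρ A) s ^ (ρ - 1) F(s) ds`, after the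
substitution `s = tθ` and division by `t ^ (2ρ - 1)`. -/
noncomputable def duhamel (v : HilbertBasis ℕ 𝕜 H) (lam : ℕ → ℝ) (ρ : ℝ) (F : ℝ → H) (t : ℝ) : H :=
  ∫ θ in (0 : ℝ)..1, ((1 - θ) ^ (ρ - 1) * θ ^ (ρ - 1)) • mlOp v lam ρ (t * (1 - θ)) (F (t * θ))

lemma mul_mem_Icc_of_mem_Ioo {t T θ : ℝ} (ht : t ∈ Icc 0 T) (hθ : θ ∈ Ioo (0 : ℝ) 1) :
    t * θ ∈ Icc 0 T :=
  ⟨mul_nonneg ht.1 hθ.1.le, (mul_le_of_le_one_right ht.1 hθ.2.le).trans ht.2⟩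

section Duhamel

variable (v : HilbertBasis ℕ 𝕜 H) {ρ : ℝ} (hρ0 : 0 < ρ) (hρ1 : ρ < 1) {lam : ℕ → ℝ}
  (hlam : ∀ k, 0 < lam k) {T : ℝ} {F : ℝ → H} (hF : ContinuousOn F (Icc 0 T))
include hρ0 hρ1 hlam hF

omit [NormedSpace ℝ H] in
lemma duhamel_integrand_continuousOn {t : ℝ} (ht : t ∈ Icc 0 T) :
    ContinuousOn (fun θ => mlOp v lam ρ (t * (1 - θ)) (F (t * θ))) (Ioo 0 1) :=
  continuousOn_mlOp v hρ0 hρ1 hlam (by fun_prop)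
    (fun θ hθ => mul_nonneg ht.1 (by linarith [hθ.2]))
    (hF.comp (by fun_prop) fun θ hθ => mul_mem_Icc_of_mem_Ioo ht hθ)

omit [NormedSpace ℝ H] in
lemma exists_norm_duhamel_integrand_le : ∃ C, ∀ t ∈ Icc 0 T, ∀ θ ∈ Ioo (0 : ℝ) 1,
    ‖mlOp v lam ρ (t * (1 - θ)) (F (t * θ))‖ ≤ C := by
  obtain ⟨B, hB⟩ := isCompact_Icc.exists_bound_of_continuousOn hF
  refine ⟨(Real.Gamma ρ)⁻¹ * B, fun t ht θ hθ => ?_⟩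
  refine (norm_mlOp_le v hρ0 hρ1 hlam (mul_nonneg ht.1 (by linarith [hθ.2])) _).trans ?_
  exact mul_le_mul_of_nonneg_left (hB _ (mul_mem_Icc_of_mem_Ioo ht hθ))
    (inv_nonneg.2 (Real.Gamma_pos_of_pos hρ0).le)

lemma continuousOn_duhamel : ContinuousOn (duhamel v lam ρ F) (Icc 0 T) := by
  obtain ⟨C, hC⟩ := exists_norm_duhamel_integrand_le v hρ0 hρ1 hlam hF
  refine continuousOn_integral_weight_smul (intervalIntegrable_weight hρ0 hρ0)
    (fun t ht => duhamel_integrand_continuousOn v hρ0 hρ1 hlam hF ht) (fun θ hθ => ?_) hC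
  exact continuousOn_mlOp v hρ0 hρ1 hlam (by fun_prop)
    (fun t ht => mul_nonneg ht.1 (by linarith [hθ.2]))
    (hF.comp (by fun_prop) fun t ht => mul_mem_Icc_of_mem_Ioo ht hθ)

lemma inner_duhamel [CompleteSpace H] [IsScalarTower ℝ 𝕜 H] {t : ℝ} (ht : t ∈ Ioc 0 T) (k : ℕ) :
    t ^ (2 * ρ - 1) • inner 𝕜 (v k) (duhamel v lam ρ F t) =
      volterra (mlKernel ρ (lam k)) (fun s => s ^ (ρ - 1) • inner 𝕜 (v k) (F s)) t := by
  have ht' : t ∈ Icc 0 T := ⟨ht.1.le, ht.2⟩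
  obtain ⟨C, hC⟩ := exists_norm_duhamel_integrand_le v hρ0 hρ1 hlam hF
  rw [duhamel, inner_intervalIntegral _ (intervalIntegrable_weight_smul
    (intervalIntegrable_weight hρ0 hρ0) (duhamel_integrand_continuousOn v hρ0 hρ1 hlam hF ht') (hC t ht')),
    volterra]
  have hsub := intervalIntegral.smul_integral_comp_mul_left (a := 0) (b := 1)
    (fun s => mlKernel ρ (lam k) (t - s) • s ^ (ρ - 1) • inner 𝕜 (v k) (F s)) t
  rw [mul_zero, mul_one] at hsub
  rw [← hsub, ← intervalIntegral.integral_smul, ← intervalIntegral.integral_smul]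
  refine intervalIntegral.integral_congr fun θ hθ => ?_
  rw [uIcc_of_le zero_le_one] at hθ
  have h1 : 0 ≤ 1 - θ := by linarith [hθ.2]
  simp only [inner_real_smul]
  rw [inner_mlOp v hρ0 hρ1 hlam (mul_nonneg ht.1.le h1), mlKernel,
    show t - t * θ = t * (1 - θ) by ring, Real.mul_rpow (z := ρ - 1) ht.1.le h1,
    Real.mul_rpow ht.1.le hθ.1, ← RCLike.real_smul_eq_coe_mul, smul_smul, smul_smul, smul_smul,
    smul_smul, show 2 * ρ - 1 = 1 + (ρ - 1) + (ρ - 1) by ring, Real.rpow_add ht.1,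
    Real.rpow_add ht.1, Real.rpow_one]
  congr 1
  ring

end Duhamel

/-- The mild solution multiplied by `t ^ (1 - ρ)`: this function is continuous up to `t = 0`. -/
noncomputable def mildProfile (v : HilbertBasis ℕ 𝕜 H) (lam : ℕ → ℝ) (ρ : ℝ) (c : H) (F : ℝ → H)
    (t : ℝ) : H := mlOp v lam ρ t c + t ^ ρ • duhamel v lam ρ F t

/-- The solution of `∂_t^ρ u + A u = t ^ (ρ - 1) F(t)` with `∂_t^(ρ-1) u (0) = c`, given by variation
of constants. -/
noncomputable def mildSol (v : HilbertBasis ℕ 𝕜 H) (lam : ℕ → ℝ) (ρ : ℝ) (c : H) (F : ℝ → H)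
    (t : ℝ) : H := t ^ (ρ - 1) • mildProfile v lam ρ c F t

/-- The image under `A` of the mild solution, where `AF` stands for `A F`. In the first term the factor
`lam k` is absorbed into the bounded multiplier `x E_{ρ,ρ}(-x)`, which leaves the singularity `t⁻¹`. -/
noncomputable def mildImage (v : HilbertBasis ℕ 𝕜 H) (lam : ℕ → ℝ) (ρ : ℝ) (c : H) (AF : ℝ → H)
    (t : ℝ) : H :=
  t⁻¹ • diagOp v (fun k => lam k * t ^ ρ * mittagLeffler ρ (-(lam k * t ^ ρ))) c +
    t ^ (2 * ρ - 1) • duhamel v lam ρ AF t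

section Mild

variable (v : HilbertBasis ℕ 𝕜 H) {ρ : ℝ} (hρ0 : 0 < ρ) (hρ1 : ρ < 1) {lam : ℕ → ℝ}
  (hlam : ∀ k, 0 < lam k) {T : ℝ} (c : H) {F AF : ℝ → H} (hF : ContinuousOn F (Icc 0 T))
  (hAF : ContinuousOn AF (Icc 0 T))
  (hFA : ∀ t ∈ Icc 0 T, ∀ k, inner 𝕜 (v k) (AF t) = (lam k : 𝕜) * inner 𝕜 (v k) (F t))
include hρ0 hρ1 hlam

omit [NormedSpace ℝ H] in
lemma abs_mul_mittagLeffler_neg_le {t : ℝ} (ht : 0 ≤ t) (k : ℕ) :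
    |lam k * t ^ ρ * mittagLeffler ρ (-(lam k * t ^ ρ))| ≤ ρ := by
  have h : 0 ≤ lam k * t ^ ρ := mul_nonneg (hlam k).le (Real.rpow_nonneg ht _)
  rw [abs_of_nonneg (mul_nonneg h (mittagLeffler_neg_pos hρ0 hρ1 h).le)]
  exact mul_mittagLeffler_neg_le hρ0 hρ1 h

include hF

lemma continuousOn_mildProfile : ContinuousOn (mildProfile v lam ρ c F) (Icc 0 T) :=
  (continuousOn_mlOp v hρ0 hρ1 hlam continuousOn_id (fun _ hs => hs.1) continuousOn_const).add
    ((Real.continuous_rpow_const hρ0.le).continuousOn.smul (continuousOn_duhamel v hρ0 hρ1 hlam hF))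

lemma continuousOn_mildSol : ContinuousOn (mildSol v lam ρ c F) (Ioc 0 T) :=
  (continuousOn_id.rpow_const fun _ hs => Or.inl hs.1.ne').smul
    ((continuousOn_mildProfile v hρ0 hρ1 hlam c hF).mono Ioc_subset_Icc_self)

lemma inner_mildSol [CompleteSpace H] [IsScalarTower ℝ 𝕜 H] {t : ℝ} (ht : t ∈ Ioc 0 T) (k : ℕ) :
    inner 𝕜 (v k) (mildSol v lam ρ c F t) = mlKernel ρ (lam k) t • inner 𝕜 (v k) c +
      volterra (mlKernel ρ (lam k)) (fun s => s ^ (ρ - 1) • inner 𝕜 (v k) (F s)) t := by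
  rw [← inner_duhamel v hρ0 hρ1 hlam hF ht, mildSol, mildProfile, smul_add, inner_add_right,
    inner_real_smul, inner_real_smul, inner_real_smul, inner_mlOp v hρ0 hρ1 hlam ht.1.le,
    ← RCLike.real_smul_eq_coe_mul, smul_smul, smul_smul, ← Real.rpow_add ht.1, mlKernel,
    show ρ - 1 + ρ = 2 * ρ - 1 by ring]

include hAF hFA

omit hF hFA in
lemma continuousOn_mildImage : ContinuousOn (mildImage v lam ρ c AF) (Ioo 0 T) := by
  refine ContinuousOn.add ?_ ?_
  · refine (continuousOn_id.inv₀ fun s hs => hs.1.ne').smul fun s hs => ?_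
    refine tendsto_diagOp v (M := ρ) ?_ (abs_mul_mittagLeffler_neg_le hρ0 hρ1 hlam hs.1.le)
      (fun k => ?_) tendsto_const_nhds
    · filter_upwards [self_mem_nhdsWithin] with r hr
      exact abs_mul_mittagLeffler_neg_le hρ0 hρ1 hlam hr.1.le
    · refine Continuous.continuousWithinAt ?_
      exact (continuous_const.mul (Real.continuous_rpow_const hρ0.le)).mul
        (continuous_mittagLeffler_rpow hρ0 hρ1 (lam k))
  · exact (continuousOn_id.rpow_const fun _ hs => Or.inl hs.1.ne').smul
      ((continuousOn_duhamel v hρ0 hρ1 hlam hAF).mono Ioo_subset_Icc_self)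

lemma inner_mildImage [CompleteSpace H] [IsScalarTower ℝ 𝕜 H] {t : ℝ} (ht : t ∈ Ioc 0 T) (k : ℕ) :
    inner 𝕜 (v k) (mildImage v lam ρ c AF t) =
      (lam k : 𝕜) * inner 𝕜 (v k) (mildSol v lam ρ c F t) := by
  rw [inner_mildSol v hρ0 hρ1 hlam c hF ht, mildImage, inner_add_right, inner_real_smul,
    inner_real_smul, inner_duhamel v hρ0 hρ1 hlam hAF ht,
    inner_diagOp v (abs_mul_mittagLeffler_neg_le hρ0 hρ1 hlam ht.1.le), mul_add,
    ← RCLike.real_smul_eq_coe_mul, ← RCLike.real_smul_eq_coe_mul, ← RCLike.real_smul_eq_coe_mul,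
    smul_smul, smul_smul]
  congr 1
  · congr 1
    rw [mlKernel, Real.rpow_sub_one ht.1.ne']
    ring
  · rw [volterra, volterra, ← intervalIntegral.integral_smul]
    refine intervalIntegral.integral_congr fun s hs => ?_
    rw [uIcc_of_le ht.1.le] at hs
    rw [hFA s ⟨hs.1, hs.2.trans ht.2⟩, ← RCLike.real_smul_eq_coe_mul, smul_smul, smul_smul, smul_smul,
      smul_smul]
    congr 1
    ring

end Mild

end Solution

/-! ### Existence and uniqueness for the backward problem -/

section FracInt

variable {E : Type*} [NormedAddCommGroup E] [NormedSpace ℝ E]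

lemma inv_rpow_eq_rpow_neg {ρ t : ℝ} {s : ℝ} (hs : s ≤ t) :
    ((t - s) ^ (ρ - 1 + 1))⁻¹ = (t - s) ^ (-ρ) := by
  rw [sub_add_cancel, Real.rpow_neg (by linarith)]

lemma fracInt_eq_volterra {ρ t : ℝ} (ht : 0 ≤ t) (h : ℝ → E) :
    fracInt (ρ - 1) h t = (Real.Gamma (1 - ρ))⁻¹ • volterra (fun x => x ^ (-ρ)) h t := by
  rw [fracInt, volterra, neg_sub]
  congr 1
  refine intervalIntegral.integral_congr fun s hs => ?_
  rw [uIcc_of_le ht] at hs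
  simp only [inv_rpow_eq_rpow_neg hs.2]

lemma fracIntegrable_iff {ρ t : ℝ} (ht : 0 ≤ t) (h : ℝ → E) :
    FracIntegrable (ρ - 1) h t ↔ IntervalIntegrable (fun s => (t - s) ^ (-ρ) • h s) volume 0 t := by
  refine intervalIntegrable_congr fun s hs => ?_
  rw [uIoc_of_le ht] at hs
  simp only [inv_rpow_eq_rpow_neg hs.2]

lemma volterra_eq_smul_fracInt {ρ t : ℝ} (hρ1 : ρ < 1) (ht : 0 ≤ t) (h : ℝ → E) :
    volterra (fun x => x ^ (-ρ)) h t = Real.Gamma (1 - ρ) • fracInt (ρ - 1) h t := by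
  rw [fracInt_eq_volterra ht, smul_inv_smul₀ (Real.Gamma_pos_of_pos (by linarith)).ne']

lemma fracIntegrable_rpow_smul {ρ : ℝ} (hρ0 : 0 < ρ) (hρ1 : ρ < 1) {q : ℝ → E} {t : ℝ} (ht : 0 < t)
    (hq : ContinuousOn q (Icc 0 t)) : FracIntegrable (ρ - 1) (fun s => s ^ (ρ - 1) • q s) t := by
  rw [fracIntegrable_iff ht.le]
  have h := intervalIntegrable_rpow_mul_rpow (a := 1 - ρ) (b := ρ) (by linarith) hρ0 ht
  rw [show 1 - ρ - 1 = -ρ by ring] at h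
  rw [← uIcc_of_le ht.le] at hq
  simpa only [mul_smul] using h.smul_continuousOn hq

/-- The initial value of `∂_t^(ρ-1) u` for `u = t ^ (ρ - 1) q` with `q` continuous up to `0`. -/
lemma tendsto_fracInt_rpow_smul [CompleteSpace E] {ρ : ℝ} (hρ0 : 0 < ρ) (hρ1 : ρ < 1) {q : ℝ → E}
    {T : ℝ} (hT : 0 < T) (hq : ContinuousOn q (Icc 0 T)) :
    Tendsto (fracInt (ρ - 1) fun s => s ^ (ρ - 1) • q s) (𝓝[>] 0) (𝓝 (Real.Gamma ρ • q 0)) := by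
  obtain ⟨B, hB⟩ := isCompact_Icc.exists_bound_of_continuousOn hq
  have hG : Real.Gamma (1 - ρ) ≠ 0 := (Real.Gamma_pos_of_pos (by linarith)).ne'
  have hcont : ContinuousOn (fun t => ∫ θ in (0 : ℝ)..1,
      ((1 - θ) ^ (1 - ρ - 1) * θ ^ (ρ - 1)) • q (t * θ)) (Icc 0 T) :=
    continuousOn_integral_weight_smul (intervalIntegrable_weight (by linarith) hρ0)
      (fun t ht => hq.comp (by fun_prop) fun θ hθ => mul_mem_Icc_of_mem_Ioo ht hθ)
      (fun θ hθ => hq.comp (by fun_prop) fun t ht => mul_mem_Icc_of_mem_Ioo ht hθ)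
      (fun t ht θ hθ => hB _ (mul_mem_Icc_of_mem_Ioo ht hθ))
  have h0 := (hcont 0 ⟨le_rfl, hT.le⟩).mono_left (nhdsWithin_mono (0 : ℝ) Ioc_subset_Icc_self)
  rw [nhdsWithin_Ioc_eq_nhdsGT hT] at h0
  have h1 := h0.const_smul (Real.Gamma (1 - ρ))⁻¹
  have hval : (Real.Gamma (1 - ρ))⁻¹ • (∫ θ in (0 : ℝ)..1,
      ((1 - θ) ^ (1 - ρ - 1) * θ ^ (ρ - 1)) • q (0 * θ)) = Real.Gamma ρ • q 0 := by
    simp only [zero_mul]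
    rw [intervalIntegral.integral_smul_const, integral_rpow_mul_rpow (by linarith) hρ0 one_pos,
      sub_add_cancel, Real.Gamma_one, Real.one_rpow, smul_smul]
    congr 1
    field_simp
  rw [hval] at h1
  refine h1.congr' ?_
  filter_upwards [self_mem_nhdsWithin] with t ht
  have ht : 0 < t := ht
  rw [fracInt_eq_volterra ht.le, volterra]
  congr 1
  have hsub := intervalIntegral.smul_integral_comp_mul_left (a := 0) (b := 1)
    (fun s => (t - s) ^ (-ρ) • s ^ (ρ - 1) • q s) t
  rw [mul_zero, mul_one] at hsub
  rw [← hsub, ← intervalIntegral.integral_smul]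
  refine intervalIntegral.integral_congr fun θ hθ => ?_
  rw [uIcc_of_le zero_le_one] at hθ
  have h1 : 0 ≤ 1 - θ := by linarith [hθ.2]
  rw [show t - t * θ = t * (1 - θ) by ring, Real.mul_rpow ht.le h1, Real.mul_rpow ht.le hθ.1,
    smul_smul, smul_smul, show 1 - ρ - 1 = -ρ by ring, Real.rpow_neg ht.le, Real.rpow_sub_one ht.ne']
  congr 1
  have : t ^ ρ ≠ 0 := (Real.rpow_pos_of_pos ht _).ne'
  field_simp

end FracInt

section Backward

variable {𝕜 H : Type*} [RCLike 𝕜] [NormedAddCommGroup H] [InnerProductSpace 𝕜 H] [CompleteSpace H]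
  [NormedSpace ℝ H] [IsScalarTower ℝ 𝕜 H]

lemma inner_fracInt {ρ t : ℝ} {u : ℝ → H} (hu : FracIntegrable (ρ - 1) u t) (x : H) :
    inner 𝕜 x (fracInt (ρ - 1) u t) = fracInt (ρ - 1) (fun s => inner 𝕜 x (u s)) t := by
  rw [fracInt, fracInt, inner_real_smul, inner_intervalIntegral x hu]
  simp only [inner_real_smul]

/-- The mild solution solves the backward problem for the final value that it attains. The equation
is checked in each coordinate in integrated form; since `f - A u` is continuous in `H` on
`(0, T)`, this gives the derivative in the norm of `H`. -/
lemma isBackwardSolution_mildSol {A : H →ₗ.[𝕜] H} (hA : IsSelfAdjoint A) {v : HilbertBasis ℕ 𝕜 H}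
    {lam : ℕ → ℝ} (hv : ∀ k, (v k, (lam k : 𝕜) • v k) ∈ A.graph) (hlam : ∀ k, 0 < lam k)
    {ρ : ℝ} (hρ0 : 0 < ρ) (hρ1 : ρ < 1) {T : ℝ} (c : H) {F AF f : ℝ → H}
    (hF : ContinuousOn F (Icc 0 T)) (hAF : ContinuousOn AF (Icc 0 T))
    (hFA : ∀ t ∈ Icc 0 T, ∀ k, inner 𝕜 (v k) (AF t) = (lam k : 𝕜) * inner 𝕜 (v k) (F t))
    (hf : ∀ t ∈ Ioo 0 T, t ^ (ρ - 1) • F t = f t) :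
    IsBackwardSolution A ρ T f (mildSol v lam ρ c F T) (mildSol v lam ρ c F) := by
  set u := mildSol v lam ρ c F with hu
  set w := mildImage v lam ρ c AF with hw
  have hG : Real.Gamma (1 - ρ) ≠ 0 := (Real.Gamma_pos_of_pos (by linarith)).ne'
  have hwc : ContinuousOn w (Ioo 0 T) := continuousOn_mildImage v hρ0 hρ1 hlam c hAF
  have hdc : ContinuousOn (fun t => t ^ (ρ - 1) • F t - w t) (Ioo 0 T) :=
    ((continuousOn_id.rpow_const fun _ hs => Or.inl hs.1.ne').smul
      (hF.mono Ioo_subset_Icc_self)).sub hwc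
  have hwu : ∀ t ∈ Ioc 0 T, ∀ k, inner 𝕜 (v k) (w t) = (lam k : 𝕜) * inner 𝕜 (v k) (u t) :=
    fun t ht k => inner_mildImage v hρ0 hρ1 hlam c hF hAF hFA ht k
  have hfi : ∀ t ∈ Ioo 0 T, FracIntegrable (ρ - 1) u t := fun t ht =>
    fracIntegrable_rpow_smul hρ0 hρ1 ht.1 ((continuousOn_mildProfile v hρ0 hρ1 hlam c hF).mono
      (Icc_subset_Icc le_rfl ht.2.le))
  -- the integrated equation in the `k`-th coordinate
  have hint (k : ℕ) : ∀ t ∈ Ioo 0 T,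
      IntervalIntegrable (fun s => s ^ (ρ - 1) • inner 𝕜 (v k) (F s)) volume 0 t ∧
      IntervalIntegrable (fun s => inner 𝕜 (v k) (u s)) volume 0 t ∧
      inner 𝕜 (v k) (fracInt (ρ - 1) u t) = inner 𝕜 (v k) c +
        (∫ s in (0 : ℝ)..t, s ^ (ρ - 1) • inner 𝕜 (v k) (F s)) -
        lam k • ∫ s in (0 : ℝ)..t, inner 𝕜 (v k) (u s) := by
    intro t ht
    have hFk : IntervalIntegrable (fun s => s ^ (ρ - 1) • inner 𝕜 (v k) (F s)) volume 0 t := by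
      refine (intervalIntegral.intervalIntegrable_rpow' (by linarith)).smul_continuousOn ?_
      rw [uIcc_of_le ht.1.le]
      exact continuousOn_const.inner (hF.mono (Icc_subset_Icc le_rfl ht.2.le))
    have heq : ∀ s ∈ Ioc 0 t, inner 𝕜 (v k) (u s) = mlKernel ρ (lam k) s • inner 𝕜 (v k) c +
        volterra (mlKernel ρ (lam k)) (fun s => s ^ (ρ - 1) • inner 𝕜 (v k) (F s)) s :=
      fun s hs => inner_mildSol v hρ0 hρ1 hlam c hF ⟨hs.1, hs.2.trans ht.2.le⟩ k
    obtain ⟨h1, h2⟩ := volterra_mild hρ0 hρ1 (hlam k).le ht.1 (inner 𝕜 (v k) c) hFk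
    refine ⟨hFk, h1.congr fun s hs => ?_, ?_⟩
    · rw [uIoc_of_le ht.1.le] at hs
      exact (heq s hs).symm
    · have e1 : (∫ s in (0 : ℝ)..t, inner 𝕜 (v k) (u s)) = ∫ s in (0 : ℝ)..t,
          (mlKernel ρ (lam k) s • inner 𝕜 (v k) c +
          volterra (mlKernel ρ (lam k)) (fun s => s ^ (ρ - 1) • inner 𝕜 (v k) (F s)) s) := by
        refine intervalIntegral.integral_congr_ae (Eventually.of_forall fun s hs => ?_)
        rw [uIoc_of_le ht.1.le] at hs
        exact heq s hs
      have e2 : volterra (fun x => x ^ (-ρ)) (fun s => inner 𝕜 (v k) (u s)) t =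
          volterra (fun x => x ^ (-ρ)) (fun s => mlKernel ρ (lam k) s • inner 𝕜 (v k) c +
          volterra (mlKernel ρ (lam k)) (fun s => s ^ (ρ - 1) • inner 𝕜 (v k) (F s)) s) t := by
        refine intervalIntegral.integral_congr_ae (Eventually.of_forall fun s hs => ?_)
        rw [uIoc_of_le ht.1.le] at hs
        exact congrArg ((t - s) ^ (-ρ) • ·) (heq s hs)
      rw [inner_fracInt (hfi t ht), fracInt_eq_volterra ht.1.le, e1, e2, h2, inv_smul_smul₀ hG]
  have hderiv : ∀ t ∈ Ioo 0 T,
      HasDerivAt (fracInt (ρ - 1) u) (t ^ (ρ - 1) • F t - w t) t := by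
    intro t ht
    have hsub {a b : ℝ} (ha : a ∈ Ioo 0 T) (hb : b ∈ Ioo 0 T) : uIcc a b ⊆ Ioo 0 T :=
      OrdConnected.uIcc_subset ordConnected_Ioo ha hb
    have hdi {a b : ℝ} (ha : a ∈ Ioo 0 T) (hb : b ∈ Ioo 0 T) :
        IntervalIntegrable (fun s => s ^ (ρ - 1) • F s - w s) volume a b :=
      (hdc.mono (hsub ha hb)).intervalIntegrable
    have hprim : ∀ s ∈ Ioo 0 T, fracInt (ρ - 1) u s =
        fracInt (ρ - 1) u t + ∫ r in t..s, (r ^ (ρ - 1) • F r - w r) := by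
      intro s hs
      refine ext_inner_hilbertBasis v fun k => ?_
      obtain ⟨i1, j1, h1⟩ := hint k t ht
      obtain ⟨i2, j2, h2⟩ := hint k s hs
      rw [inner_add_right, h1, h2, inner_intervalIntegral _ (hdi ht hs)]
      have e1 : (∫ r in t..s, inner 𝕜 (v k) (r ^ (ρ - 1) • F r - w r)) =
          ∫ r in t..s, (r ^ (ρ - 1) • inner 𝕜 (v k) (F r) - lam k • inner 𝕜 (v k) (u r)) := by
        refine intervalIntegral.integral_congr fun r hr => ?_
        have hr' := hsub ht hs hr
        rw [inner_sub_right, inner_real_smul, hwu r ⟨hr'.1, hr'.2.le⟩,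
          RCLike.real_smul_eq_coe_mul (lam k)]
      have j3 : IntervalIntegrable (fun r => lam k • inner 𝕜 (v k) (u r)) volume t s :=
        (j1.symm.trans j2).smul (lam k)
      rw [e1, intervalIntegral.integral_sub (i1.symm.trans i2) j3, intervalIntegral.integral_smul,
        ← intervalIntegral.integral_interval_sub_left i2 i1,
        ← intervalIntegral.integral_interval_sub_left j2 j1]
      module
    have h1 := intervalIntegral.integral_hasDerivAt_right (hdi ht ht)
      (hdc.stronglyMeasurableAtFilter isOpen_Ioo t ht)
      (hdc.continuousAt (isOpen_Ioo.mem_nhds ht))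
    refine (h1.const_add (fracInt (ρ - 1) u t)).congr_of_eventuallyEq ?_
    filter_upwards [isOpen_Ioo.mem_nhds ht] with s hs using hprim s hs
  refine ⟨continuousOn_mildSol v hρ0 hρ1 hlam c hF, ⟨fun t => t ^ (ρ - 1) • F t - w t, w,
    fun t ht => ⟨hfi t ht, hderiv t ht⟩, hdc, fun t ht => ?_, hwc, fun t ht => ?_⟩, rfl⟩
  · exact mem_graph_of_inner hA hv (hwu t ⟨ht.1, ht.2.le⟩)
  · rw [sub_add_cancel, hf t ht]

omit [IsScalarTower ℝ 𝕜 H] in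
/-- A real functional which is an eigenvector of `A` takes the same values on two solutions of the
backward problem. -/
lemma IsBackwardSolution.functional_eq {A : H →ₗ.[𝕜] H} {ρ : ℝ} (hρ0 : 0 < ρ) (hρ1 : ρ < 1) {T : ℝ}
    (hT : 0 < T) {f : ℝ → H} {Φ : H} {u u' : ℝ → H} (hu : IsBackwardSolution A ρ T f Φ u)
    (hu' : IsBackwardSolution A ρ T f Φ u') (φ : H →L[ℝ] ℝ) {lam : ℝ} (hlam : 0 ≤ lam)
    (hφ : ∀ x w, (x, w) ∈ A.graph → φ w = lam * φ x) : ∀ t ∈ Ioc 0 T, φ (u t) = φ (u' t) := by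
  obtain ⟨d, w, hd, -, hw, -, heq⟩ := hu.equation
  obtain ⟨d', w', hd', -, hw', -, heq'⟩ := hu'.equation
  have hi {z : ℝ → H} {t : ℝ} (ht : 0 ≤ t) (hz : FracIntegrable (ρ - 1) z t) :
      IntervalIntegrable (fun s => (t - s) ^ (-ρ) * φ (z s)) volume 0 t ∧
      volterra (fun x => x ^ (-ρ)) (fun s => φ (z s)) t =
        Real.Gamma (1 - ρ) * φ (fracInt (ρ - 1) z t) := by
    have h1 := (fracIntegrable_iff ht z).1 hz
    have h2 : IntervalIntegrable (fun s => φ ((t - s) ^ (-ρ) • z s)) volume 0 t :=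
      ⟨φ.integrable_comp h1.1, φ.integrable_comp h1.2⟩
    simp only [map_smul, smul_eq_mul] at h2
    refine ⟨h2, ?_⟩
    rw [← smul_eq_mul, ← map_smul, ← volterra_eq_smul_fracInt hρ1 ht, volterra, volterra,
      ← φ.intervalIntegral_comp_comm h1]
    simp only [map_smul]
  have hz := eq_zero_of_backward hρ0 hρ1 (y := fun t => φ (u t) - φ (u' t)) hlam hT
    ((φ.continuous.comp_continuousOn hu.continuousOn).sub
      (φ.continuous.comp_continuousOn hu'.continuousOn)) (fun t ht => ?_) (fun t ht => ?_)
    (by rw [hu.final, hu'.final, sub_self])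
  · exact fun t ht => sub_eq_zero.1 (hz t ht)
  · simpa only [mul_sub] using (hi ht.1.le (hd t ht).1).1.sub (hi ht.1.le (hd' t ht).1).1
  · have hder := ((φ.hasFDerivAt.comp_hasDerivAt t (hd t ht).2).sub
      (φ.hasFDerivAt.comp_hasDerivAt t (hd' t ht).2)).const_mul (Real.Gamma (1 - ρ))
    refine (hder.congr_of_eventuallyEq ?_).congr_deriv ?_
    · filter_upwards [isOpen_Ioo.mem_nhds ht] with s hs
      have h1 := hi hs.1.le (hd s hs).1
      have h2 := hi hs.1.le (hd' s hs).1
      simp only [Pi.sub_apply, Function.comp_apply, mul_sub]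
      rw [← h1.2, ← h2.2]
      simp only [volterra, smul_eq_mul, mul_sub]
      exact intervalIntegral.integral_sub h1.1 h2.1
    · have e1 : d t - d' t = w' t - w t := by
        rw [sub_eq_sub_iff_add_eq_add, add_comm (w' t), heq t ht, heq' t ht]
      rw [← map_sub, e1, map_sub, hφ _ _ (hw t ht), hφ _ _ (hw' t ht)]
      ring

lemma IsBackwardSolution.eqOn {A : H →ₗ.[𝕜] H} (hA : IsSelfAdjoint A) {v : HilbertBasis ℕ 𝕜 H}
    {lam : ℕ → ℝ} (hv : ∀ k, (v k, (lam k : 𝕜) • v k) ∈ A.graph) (hlam : ∀ k, 0 < lam k)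
    {ρ : ℝ} (hρ0 : 0 < ρ) (hρ1 : ρ < 1) {T : ℝ} (hT : 0 < T) {f : ℝ → H} {Φ : H} {u u' : ℝ → H}
    (hu : IsBackwardSolution A ρ T f Φ u) (hu' : IsBackwardSolution A ρ T f Φ u') :
    EqOn u u' (Ioc 0 T) := by
  intro t ht
  refine ext_inner_hilbertBasis v fun k => RCLike.ext ?_ ?_
  · refine hu.functional_eq hρ0 hρ1 hT hu'
      ((RCLike.reCLM : 𝕜 →L[ℝ] ℝ).comp ((innerSL 𝕜 (v k)).restrictScalars ℝ)) (hlam k).le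
      (fun x w h => ?_) t ht
    simp [inner_of_mem_graph hA hv h k]
  · refine hu.functional_eq hρ0 hρ1 hT hu'
      ((RCLike.imCLM : 𝕜 →L[ℝ] ℝ).comp ((innerSL 𝕜 (v k)).restrictScalars ℝ)) (hlam k).le
      (fun x w h => ?_) t ht
    simp [inner_of_mem_graph hA hv h k]

end Backward

/-! ### The initial value and the estimate -/

section InitialValue

lemma rpow_mul_mittagLeffler_neg_le {ρ : ℝ} (hρ0 : 0 < ρ) (hρ1 : ρ < 1) {s y : ℝ} (hs0 : 0 ≤ s)
    (hs1 : s ≤ 1) (hy : 0 ≤ y) : y ^ s * mittagLeffler ρ (-y) ≤ max (Real.Gamma ρ)⁻¹ ρ := by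
  have hE := (mittagLeffler_neg_pos hρ0 hρ1 hy).le
  rcases le_total y 1 with h | h
  · refine le_trans ?_ (le_max_left _ _)
    exact (mul_le_of_le_one_left hE (Real.rpow_le_one hy h hs0)).trans
      (mittagLeffler_neg_le_inv_Gamma hρ0 hρ1 hy)
  · refine le_trans ?_ (le_max_right _ _)
    refine le_trans (mul_le_mul_of_nonneg_right ?_ hE) (mul_mittagLeffler_neg_le hρ0 hρ1 hy)
    simpa using Real.rpow_le_rpow_of_exponent_le h hs1

lemma exists_inv_sq_mul_mlKernel_le {ρ : ℝ} (hρ0 : 0 < ρ) (hρ1 : ρ < 1) {T lam₀ : ℝ} (hT : 0 < T)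
    (hlam₀ : 0 < lam₀) :
    ∃ C : ℝ, 0 < C ∧ ∀ lam, lam₀ ≤ lam → (lam ^ 2 * mlKernel ρ lam T)⁻¹ ≤ C := by
  obtain ⟨c, hc, hle⟩ := exists_le_sq_mul_mittagLeffler_neg hρ0 hρ1
  have hTρ : 0 < T ^ ρ := Real.rpow_pos_of_pos hT _
  have hTρ' : 0 < T ^ (ρ - 1) := Real.rpow_pos_of_pos hT _
  set K := 1 / lam₀ + T ^ ρ with hK
  have hK0 : 0 < K := by positivity
  refine ⟨(c * T ^ (ρ - 1) / K ^ 2)⁻¹, by positivity, fun lam hlam => ?_⟩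
  have hlam0 : 0 < lam := hlam₀.trans_le hlam
  refine inv_anti₀ (by positivity) ?_
  have hx : 0 ≤ lam * T ^ ρ := by positivity
  have hE := mittagLeffler_neg_pos hρ0 hρ1 hx
  have h1 : 1 + lam * T ^ ρ ≤ K * lam := by
    have : 1 ≤ 1 / lam₀ * lam := by rw [one_div_mul_eq_div, one_le_div hlam₀]; exact hlam
    rw [hK, add_mul]
    linarith
  have h2 : c ≤ (K * lam) ^ 2 * mittagLeffler ρ (-(lam * T ^ ρ)) :=
    (hle _ hx).trans (by gcongr)
  rw [div_le_iff₀ (by positivity), mlKernel]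
  calc c * T ^ (ρ - 1) ≤ (K * lam) ^ 2 * mittagLeffler ρ (-(lam * T ^ ρ)) * T ^ (ρ - 1) := by gcongr
    _ = _ := by ring

/-- The multiplier that recovers the Duhamel part of the initial value from `A ^ (1 + ε) F` is bounded
uniformly in `lam ≥ lam₀` and `θ ∈ (0, 1)`, once the singularity in `θ` is taken out. -/
lemma exists_duhamel_multiplier_le {ρ : ℝ} (hρ0 : 0 < ρ) (hρ1 : ρ < 1) {T lam₀ : ℝ} (hT : 0 < T)
    (hlam₀ : 0 < lam₀) {ε δ : ℝ} (hδ0 : 0 ≤ δ) (hδε : δ ≤ ε) (hδ1 : δ ≤ 1) :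
    ∃ C : ℝ, 0 ≤ C ∧ ∀ lam, lam₀ ≤ lam → ∀ θ ∈ Ioo (0 : ℝ) 1,
      |T ^ (2 * ρ - 1) * (1 - θ) ^ (ρ * (1 - δ)) * mittagLeffler ρ (-(lam * (T * (1 - θ)) ^ ρ)) *
        lam ^ (-(1 + ε)) / mlKernel ρ lam T| ≤ C := by
  obtain ⟨C₁, hC₁, hinv⟩ := exists_inv_sq_mul_mlKernel_le hρ0 hρ1 hT hlam₀
  set C₃ := max (Real.Gamma ρ)⁻¹ ρ with hC₃
  have hC₃0 : 0 < C₃ := lt_max_of_lt_right hρ0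
  refine ⟨T ^ (2 * ρ - 1) * (lam₀ ^ (δ - ε) * T ^ (-(ρ * (1 - δ))) * C₃) * C₁, by positivity,
    fun lam hlam θ hθ => ?_⟩
  have hlam0 : 0 < lam := hlam₀.trans_le hlam
  have hθ0 : 0 < 1 - θ := by linarith [hθ.2]
  set a := (T * (1 - θ)) ^ ρ with ha
  have ha0 : 0 < a := by positivity
  have hE := mittagLeffler_neg_pos hρ0 hρ1 (x := lam * a) (by positivity)
  have he := mlKernel_pos hρ0 hρ1 hlam0.le hT
  have hy := rpow_mul_mittagLeffler_neg_le hρ0 hρ1 (s := 1 - δ) (y := lam * a) (by linarith)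
    (by linarith) (by positivity)
  have hpow : (1 - θ) ^ (ρ * (1 - δ)) * lam ^ (-(1 + ε)) =
      lam ^ (δ - ε) * T ^ (-(ρ * (1 - δ))) * (lam * a) ^ (1 - δ) * (lam ^ 2)⁻¹ := by
    rw [Real.mul_rpow hlam0.le ha0.le, ha, ← Real.rpow_mul (by positivity), Real.mul_rpow hT.le hθ0.le,
      Real.rpow_neg hT.le]
    have h1 : lam ^ (-(1 + ε)) = lam ^ (δ - ε) * lam ^ (1 - δ) * (lam ^ 2)⁻¹ := by
      rw [← Real.rpow_natCast lam 2, ← Real.rpow_neg hlam0.le, ← Real.rpow_add hlam0,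
        ← Real.rpow_add hlam0]
      congr 1
      push_cast
      ring
    have h2 : T ^ (ρ * (1 - δ)) ≠ 0 := (Real.rpow_pos_of_pos hT _).ne'
    rw [h1]
    field_simp
  have hl := Real.rpow_le_rpow_of_nonpos hlam₀ hlam (show δ - ε ≤ 0 by linarith)
  rw [abs_of_pos (by positivity)]
  calc _ = T ^ (2 * ρ - 1) * ((1 - θ) ^ (ρ * (1 - δ)) * lam ^ (-(1 + ε))) *
        mittagLeffler ρ (-(lam * a)) / mlKernel ρ lam T := by ring
    _ = T ^ (2 * ρ - 1) * (lam ^ (δ - ε) * T ^ (-(ρ * (1 - δ))) *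
        ((lam * a) ^ (1 - δ) * mittagLeffler ρ (-(lam * a)))) * (lam ^ 2 * mlKernel ρ lam T)⁻¹ := by
        rw [hpow, mul_inv]; ring
    _ ≤ _ := mul_le_mul (mul_le_mul_of_nonneg_left (mul_le_mul
        (mul_le_mul_of_nonneg_right hl (by positivity)) hy (by positivity) (by positivity))
        (by positivity)) (hinv lam hlam) (by positivity) (by positivity)

variable {𝕜 H : Type*} [RCLike 𝕜] [NormedAddCommGroup H] [InnerProductSpace 𝕜 H] [CompleteSpace H]
  [NormedSpace ℝ H] [IsScalarTower ℝ 𝕜 H]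

/-- The initial value `c` of `∂_t^(ρ-1) u` for which the mild solution attains `Φ` at time `T`. In the
`k`-th coordinate it is the difference of `Φ` and the Duhamel term divided by
`mlKernel ρ (lam k) T`, which costs two powers of `A`; one of them is regained from the decay of the
kernel inside the Duhamel integral, up to the `ε` that keeps the integral convergent. -/
lemma exists_initial_value (v : HilbertBasis ℕ 𝕜 H) {ρ : ℝ} (hρ0 : 0 < ρ) (hρ1 : ρ < 1) {T : ℝ}
    (hT : 0 < T) {lam : ℕ → ℝ} {lam₀ : ℝ} (hlam₀ : 0 < lam₀) (hle : ∀ k, lam₀ ≤ lam k) {ε : ℝ}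
    (hε : 0 < ε) :
    ∃ C : ℝ, 0 < C ∧ ∀ (F G : ℝ → H) (M : ℝ) (Φ Ψ : H), ContinuousOn F (Icc 0 T) →
      ContinuousOn G (Icc 0 T) → (∀ t ∈ Icc 0 T, IsPow v lam (1 + ε) (F t) (G t)) →
      (∀ t ∈ Icc 0 T, ‖G t‖ ≤ M) → IsPow v lam 2 Φ Ψ →
      ∃ c : H, ‖c‖ ≤ C * (‖Ψ‖ + M) ∧ mildSol v lam ρ c F T = Φ := by
  have hlam : ∀ k, 0 < lam k := fun k => hlam₀.trans_le (hle k)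
  -- the bound `x E_{ρ,ρ}(-x) ≤ ρ` regains at most one power of `A`, so only `min ε 1` matters
  set δ := min ε 1 with hδ
  have hδ0 : 0 < δ := lt_min hε one_pos
  have hδ1 : δ ≤ 1 := min_le_right _ _
  obtain ⟨C₁, hC₁, hm₁⟩ := exists_inv_sq_mul_mlKernel_le hρ0 hρ1 hT hlam₀
  obtain ⟨C₂, hC₂, hm₂⟩ := exists_duhamel_multiplier_le hρ0 hρ1 hT hlam₀ hδ0.le (min_le_left ε 1) hδ1
  have hek : ∀ k, 0 < mlKernel ρ (lam k) T := fun k => mlKernel_pos hρ0 hρ1 (hlam k).le hT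
  set wt : ℝ → ℝ := fun θ => (1 - θ) ^ (ρ * δ - 1) * θ ^ (ρ - 1) with hwt
  have hwi : IntervalIntegrable wt volume 0 1 := intervalIntegrable_weight (by positivity) hρ0
  have hw0 : ∀ θ ∈ Ioo (0 : ℝ) 1, 0 ≤ wt θ := fun θ hθ =>
    mul_nonneg (Real.rpow_nonneg (by linarith [hθ.2]) _) (Real.rpow_nonneg hθ.1.le _)
  set B := ∫ θ in (0 : ℝ)..1, wt θ with hB
  have hB0 : 0 ≤ B := by
    refine intervalIntegral.integral_nonneg zero_le_one fun θ hθ => ?_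
    exact mul_nonneg (Real.rpow_nonneg (by linarith [hθ.2]) _) (Real.rpow_nonneg hθ.1 _)
  refine ⟨C₁ + B * C₂, by positivity, fun F G M Φ Ψ hF hG hFG hM hΨ => ?_⟩
  set m₁ : ℕ → ℝ := fun k => (lam k ^ 2 * mlKernel ρ (lam k) T)⁻¹ with hm₁def
  set m₂ : ℝ → ℕ → ℝ := fun θ k => T ^ (2 * ρ - 1) * (1 - θ) ^ (ρ * (1 - δ)) *
    mittagLeffler ρ (-(lam k * (T * (1 - θ)) ^ ρ)) * lam k ^ (-(1 + ε)) / mlKernel ρ (lam k) T with hm₂def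
  have hb₁ : ∀ k, |m₁ k| ≤ C₁ := fun k => by
    have := hek k
    rw [abs_of_nonneg (by positivity)]
    exact hm₁ _ (hle k)
  have hb₂ : ∀ θ ∈ Ioo (0 : ℝ) 1, ∀ k, |m₂ θ k| ≤ C₂ := fun θ hθ k => hm₂ _ (hle k) θ hθ
  have hTθ : ∀ θ ∈ Ioo (0 : ℝ) 1, T * θ ∈ Icc 0 T := fun θ hθ =>
    mul_mem_Icc_of_mem_Ioo ⟨hT.le, le_rfl⟩ hθ
  have hQc : ContinuousOn (fun θ => diagOp v (m₂ θ) (G (T * θ))) (Ioo 0 1) := by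
    intro θ hθ
    refine tendsto_diagOp v (M := C₂) ?_ (hb₂ θ hθ) (fun k => ?_)
      ((hG.comp (by fun_prop) hTθ) θ hθ)
    · filter_upwards [self_mem_nhdsWithin] with r hr using hb₂ r hr
    · refine Continuous.continuousWithinAt ?_
      have h1 : Continuous fun θ : ℝ => (1 - θ) ^ (ρ * (1 - δ)) :=
        (Real.continuous_rpow_const (mul_nonneg hρ0.le (by linarith))).comp
          (continuous_const.sub continuous_id)
      have h2 : Continuous fun θ : ℝ => mittagLeffler ρ (-(lam k * (T * (1 - θ)) ^ ρ)) :=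
        (continuous_mittagLeffler_rpow hρ0 hρ1 (lam k)).comp (by fun_prop)
      exact (((continuous_const.mul h1).mul h2).mul continuous_const).div_const _
  have hQb : ∀ θ ∈ Ioo (0 : ℝ) 1, ‖diagOp v (m₂ θ) (G (T * θ))‖ ≤ C₂ * M := fun θ hθ =>
    (norm_diagOp_le v (hb₂ θ hθ) _).trans (mul_le_mul_of_nonneg_left (hM _ (hTθ θ hθ)) hC₂)
  have hM0 : 0 ≤ M := (norm_nonneg _).trans (hM 0 ⟨le_rfl, hT.le⟩)
  refine ⟨diagOp v m₁ Ψ - ∫ θ in (0 : ℝ)..1, wt θ • diagOp v (m₂ θ) (G (T * θ)), ?_, ?_⟩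
  · have h1 := norm_diagOp_le v hb₁ Ψ
    have h2 := norm_integral_weight_smul_le hwi hw0 hQb
    have h3 := norm_nonneg Ψ
    refine (norm_sub_le _ _).trans ((add_le_add h1 h2).trans ?_)
    have : 0 ≤ C₁ * M + B * C₂ * ‖Ψ‖ := by positivity
    nlinarith
  · refine ext_inner_hilbertBasis v fun k => ?_
    have hTm : T ∈ Ioc 0 T := ⟨hT, le_rfl⟩
    have hTm' : T ∈ Icc 0 T := ⟨hT.le, le_rfl⟩
    have hk := hlam k
    have hekk := hek k
    rw [inner_mildSol v hρ0 hρ1 hlam _ hF hTm, ← inner_duhamel v hρ0 hρ1 hlam hF hTm, inner_sub_right,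
      inner_diagOp v hb₁, inner_intervalIntegral _ (intervalIntegrable_weight_smul hwi hQc hQb),
      duhamel]
    obtain ⟨C, hC⟩ := exists_norm_duhamel_integrand_le v hρ0 hρ1 hlam hF
    rw [inner_intervalIntegral _ (intervalIntegrable_weight_smul (intervalIntegrable_weight hρ0 hρ0)
      (duhamel_integrand_continuousOn v hρ0 hρ1 hlam hF hTm') (hC T hTm'))]
    have hmatch : mlKernel ρ (lam k) T • (∫ θ in (0 : ℝ)..1,
          inner 𝕜 (v k) (wt θ • diagOp v (m₂ θ) (G (T * θ)))) =
        T ^ (2 * ρ - 1) • ∫ θ in (0 : ℝ)..1, inner 𝕜 (v k)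
          (((1 - θ) ^ (ρ - 1) * θ ^ (ρ - 1)) • mlOp v lam ρ (T * (1 - θ)) (F (T * θ))) := by
      rw [← intervalIntegral.integral_smul, ← intervalIntegral.integral_smul]
      refine intervalIntegral.integral_congr_ae ?_
      filter_upwards [Measure.ae_ne volume (1 : ℝ)] with θ hθ1 hθ
      rw [uIoc_of_le zero_le_one] at hθ
      have hθ' : θ ∈ Ioo (0 : ℝ) 1 := ⟨hθ.1, lt_of_le_of_ne hθ.2 hθ1⟩
      have h0 : 0 < 1 - θ := by linarith [hθ'.2]
      rw [inner_real_smul, inner_real_smul, inner_diagOp v (hb₂ θ hθ'), hFG _ (hTθ θ hθ') k,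
        inner_mlOp v hρ0 hρ1 hlam (by positivity), ← RCLike.real_smul_eq_coe_mul,
        ← RCLike.real_smul_eq_coe_mul, ← RCLike.real_smul_eq_coe_mul, smul_smul, smul_smul, smul_smul,
        smul_smul, smul_smul, hwt, hm₂def]
      congr 1
      have e1 : (1 - θ) ^ (ρ - 1) = (1 - θ) ^ (ρ * δ - 1) * (1 - θ) ^ (ρ * (1 - δ)) := by
        rw [← Real.rpow_add h0]
        congr 1
        ring
      have e2 : lam k ^ (1 + ε) ≠ 0 := (Real.rpow_pos_of_pos hk _).ne'
      simp only
      rw [e1, Real.rpow_neg hk.le]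
      field_simp
    rw [smul_sub, hmatch, sub_add_cancel, hΨ k, ← RCLike.real_smul_eq_coe_mul,
      ← RCLike.real_smul_eq_coe_mul, smul_smul, smul_smul, hm₁def]
    have e3 : mlKernel ρ (lam k) T * ((lam k ^ 2 * mlKernel ρ (lam k) T)⁻¹ * lam k ^ (2 : ℝ)) = 1 := by
      rw [Real.rpow_two]
      field_simp
    simp only [← mul_assoc] at e3 ⊢
    rw [e3, one_smul]

end InitialValue

theorem theorem2 {𝕜 H : Type*} [RCLike 𝕜] [NormedAddCommGroup H] [InnerProductSpace 𝕜 H]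
    [CompleteSpace H] [NormedSpace ℝ H] [IsScalarTower ℝ 𝕜 H]
    (A : H →ₗ.[𝕜] H) (hA : IsSelfAdjoint A)
    (v : HilbertBasis ℕ 𝕜 H) (lam : ℕ → ℝ)
    (hv : ∀ k, (v k, (lam k : 𝕜) • v k) ∈ A.graph)
    (hpos : 0 < lam 0) (hmono : Monotone lam) (hlim : Tendsto lam atTop atTop)
    (ρ : ℝ) (hρ0 : 0 < ρ) (hρ1 : ρ < 1) (T : ℝ) (hT : 0 < T) (ε : ℝ) (hε : 0 < ε) :
    ∃ C : ℝ, 0 < C ∧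
      -- `F` is the function `t ^ (1 - ρ) f(t)`, extended by continuity to `[0, T]`
      ∀ f F : ℝ → H, (∀ t ∈ Ioo 0 T, F t = t ^ (1 - ρ) • f t) →
        ContInPowDomain v lam (1 + ε) T F →
        ∀ Φ : H, MemPowDomain v lam 2 Φ →
          (∃ u : ℝ → H, IsBackwardSolution A ρ T f Φ u ∧
            ∀ u' : ℝ → H, IsBackwardSolution A ρ T f Φ u' → EqOn u' u (Ioc 0 T)) ∧
          ∀ u : ℝ → H, IsBackwardSolution A ρ T f Φ u →
            ∃ L : ℝ, Tendsto (fun t => ‖fracInt (ρ - 1) u t‖) (𝓝[>] 0) (𝓝 L) ∧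
              L ≤ C * (powNorm v lam 2 Φ + maxPowNorm v lam (1 + ε) T F) := by
  have hle : ∀ k, lam 0 ≤ lam k := fun k => hmono (Nat.zero_le k)
  have hlam : ∀ k, 0 < lam k := fun k => hpos.trans_le (hle k)
  obtain ⟨C, hC, hinit⟩ := exists_initial_value v hρ0 hρ1 hT hpos hle hε
  refine ⟨C, hC, fun f F hfF hFdom Φ hΦ => ?_⟩
  obtain ⟨G, hG, hFG, hGM⟩ := hFdom.exists_isPow hlam
  obtain ⟨Ψ, hΨ⟩ := hΦ.exists_isPow hlam
  -- negative powers of `A` are bounded diagonal operators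
  have hneg {τ : ℝ} (hτ : 0 ≤ τ) : ∀ k, |lam k ^ (-τ)| ≤ lam 0 ^ (-τ) := fun k => by
    rw [abs_of_nonneg (Real.rpow_nonneg (hlam k).le _)]
    exact Real.rpow_le_rpow_of_nonpos hpos (hle k) (by linarith)
  have hcontG {τ : ℝ} (hτ : 0 ≤ τ) :
      ContinuousOn (fun t => diagOp v (fun k => lam k ^ (-τ)) (G t)) (Icc 0 T) := fun t ht =>
    tendsto_diagOp v (Eventually.of_forall fun _ => hneg hτ) (hneg hτ) (fun _ => tendsto_const_nhds)
      (hG t ht)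
  have hF : ContinuousOn F (Icc 0 T) := by
    refine (hcontG (τ := 1 + ε) (by linarith)).congr fun t ht => ext_inner_hilbertBasis v fun k => ?_
    rw [inner_diagOp v (hneg (by linarith)), hFG t ht k, ← mul_assoc, ← RCLike.ofReal_mul,
      ← Real.rpow_add (hlam k), neg_add_cancel, Real.rpow_zero, RCLike.ofReal_one, one_mul]
  have hFA : ∀ t ∈ Icc 0 T, ∀ k, inner 𝕜 (v k) (diagOp v (fun k => lam k ^ (-ε)) (G t)) =
      (lam k : 𝕜) * inner 𝕜 (v k) (F t) := fun t ht k => by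
    rw [inner_diagOp v (hneg hε.le), hFG t ht k, ← mul_assoc, ← RCLike.ofReal_mul,
      ← Real.rpow_add (hlam k), show -ε + (1 + ε) = 1 by ring, Real.rpow_one]
  have hf : ∀ t ∈ Ioo 0 T, t ^ (ρ - 1) • F t = f t := fun t ht => by
    rw [hfF t ht, smul_smul, ← Real.rpow_add ht.1, show ρ - 1 + (1 - ρ) = 0 by ring, Real.rpow_zero,
      one_smul]
  obtain ⟨c, hc, hcΦ⟩ := hinit F G _ Φ Ψ hF hG hFG hGM hΨ
  have hsol := isBackwardSolution_mildSol hA hv hlam hρ0 hρ1 c hF (hcontG hε.le) hFA hf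
  rw [hcΦ] at hsol
  refine ⟨⟨_, hsol, fun u' hu' => hu'.eqOn hA hv hlam hρ0 hρ1 hT hsol⟩, fun u hu => ⟨‖c‖, ?_, ?_⟩⟩
  · have hlimc := tendsto_fracInt_rpow_smul hρ0 hρ1 hT (continuousOn_mildProfile v hρ0 hρ1 hlam c hF)
    have h0 : Real.Gamma ρ • mildProfile v lam ρ c F 0 = c := by
      refine ext_inner_hilbertBasis v fun k => ?_
      rw [mildProfile, Real.zero_rpow hρ0.ne', zero_smul, add_zero, inner_real_smul,
        inner_mlOp v hρ0 hρ1 hlam le_rfl, Real.zero_rpow hρ0.ne', mul_zero, neg_zero,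
        mittagLeffler_zero hρ0 hρ1, ← RCLike.real_smul_eq_coe_mul,
        smul_inv_smul₀ (Real.Gamma_pos_of_pos hρ0).ne']
    rw [h0] at hlimc
    refine (hlimc.congr' ?_).norm
    have heq := hu.eqOn hA hv hlam hρ0 hρ1 hT hsol
    filter_upwards [Ioo_mem_nhdsGT hT] with t ht
    rw [fracInt, fracInt]
    congr 1
    refine intervalIntegral.integral_congr_ae (Eventually.of_forall fun s hs => ?_)
    rw [uIoc_of_le ht.1.le] at hs
    rw [heq ⟨hs.1, hs.2.trans ht.2.le⟩]
    rfl
  · rwa [hΨ.powNorm_eq hlam]
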